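/- Let $\mathbb{F}$ be a field and $n\ge 1$ an integer. Let $$\mathrm{AGL}_n(\mathbb{F})=\left\{\begin{pmatrix}1&v\\0&A\end{pmatrix}: v\in\mathbb{F}^n,\ A\in\mathrm{GL}_n(\mathbb{F})\right\}\le \mathrm{GL}_{n+1}(\mathbb{F})$$ be the affine group, and call an element of it a translation if $A=I_n$. A subgroup $R$ of $\mathrm{AGL}_n(\mathbb{F})$ is called regular if for every $v\in\mathbb{F}^n$ there is a unique element of $R$ with first row $(1,v)$, and unipotent if $r-I_{n+1}$ is nilpotent for every $r\in R$. Let $R$ be a regular subgroup of $\mathrm{AGL}_n(\mathbb{F})$, and suppose that $R$ is unipotent if $\operatorname{char}\mathbb{F}=0$. Assume that one of the following conditions holds: (i) $n\le 2$; (ii) $n=3$ and $|\mathbb{F}|\ne 2$; (iii) $n=4$ and $\operatorname{char}\mathbb{F}=2$. Then $R$ contains a translation different from the identity. -/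

import Mathlib

/-- The affine group `AGL_n(F)`: the subgroup of `GL_{n+1}(F)` of the block matrices
`(1 v; 0 A)` (then `A` is automatically invertible), that is, of the invertible matrices whose
first column is `(1, 0, …, 0)ᵀ`. It acts on the right on row vectors of length `n + 1`. -/
def AGL (n : ℕ) (F : Type*) [Field F] : Subgroup (GL (Fin (n + 1)) F) where
  carrier := {g | (g : Matrix (Fin (n + 1)) (Fin (n + 1)) F) 0 0 = 1 ∧
    ∀ i : Fin n, (g : Matrix (Fin (n + 1)) (Fin (n + 1)) F) i.succ 0 = 0}
  one_mem' := by simp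
  mul_mem' := by
    rintro a b ⟨ha, ha'⟩ ⟨hb, hb'⟩
    simp [Matrix.mul_apply, Fin.sum_univ_succ, ha, ha', hb, hb']
  inv_mem' := by
    rintro a ⟨ha, ha'⟩
    have h : ∀ i, (a⁻¹ * a : GL (Fin (n + 1)) F).val i 0 = (a⁻¹ : GL (Fin (n + 1)) F).val i 0 := by
      intro i
      rw [Units.val_mul, Matrix.mul_apply, Fin.sum_univ_succ, ha]
      simp [ha']
    simp only [inv_mul_cancel, Units.val_one] at h
    refine ⟨?_, fun i => ?_⟩
    · rw [← h 0]; simp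
    · rw [← h i.succ]; simp

namespace AGL

variable {n : ℕ} {F : Type*} [Field F]

/-- The underlying matrix of an element of the affine group. -/
def toMatrix (r : AGL n F) : Matrix (Fin (n + 1)) (Fin (n + 1)) F :=
  ((r : GL (Fin (n + 1)) F) : Matrix (Fin (n + 1)) (Fin (n + 1)) F)

/-- The homomorphism `π : AGL_n(F) → GL_n(F)`, `(1 v; 0 A) ↦ A`. -/
def linearPart : AGL n F →* GL (Fin n) F :=
  MonoidHom.toHomUnits
    { toFun := fun r => (toMatrix r).submatrix Fin.succ Fin.succ
      map_one' := by
        ext i j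
        simp [toMatrix, Matrix.one_apply]
      map_mul' := by
        intro a b
        ext i j
        have ha : (a : GL (Fin (n + 1)) F).val i.succ 0 = 0 := a.2.2 i
        simp [toMatrix, Matrix.mul_apply, Fin.sum_univ_succ, ha] }

/-- The group of translations, the kernel of `π`. -/
def translations (n : ℕ) (F : Type*) [Field F] : Subgroup (AGL n F) :=
  (linearPart (n := n) (F := F)).ker

/-- A subgroup `R` of `AGL_n(F)` is regular if for every `v` there is a unique element of `R`
whose first row is the affine point `(1, v)`. -/
def IsRegular (R : Subgroup (AGL n F)) : Prop :=
  ∀ v : Fin n → F, ∃! r : AGL n F, r ∈ R ∧ toMatrix r 0 = (Fin.cons 1 v : Fin (n + 1) → F)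

/-- A subgroup is unipotent if all its elements are unipotent matrices. -/
def IsUnipotent (R : Subgroup (AGL n F)) : Prop :=
  ∀ r ∈ R, IsNilpotent (toMatrix r - 1)

end AGL

/-! Suppose the only translation in `R` is the identity. As matrices act on rows from the right, the
opposite group of `R` then has a faithful linear part `ρ` and a bijective cocycle `δ`
(`RegularCocycle`). The linear part is unipotent: by hypothesis in characteristic zero, and in
characteristic `p` because some `g ^ p ^ k` fixes a point and so is trivial
(`isNilpotent_of_charP`). Kolchin's theorem makes it unitriangular (`exists_basis_unitriangular`).

The engine is that an element with trivial linear part is `1`, so each commutator with trivial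
linear part yields a relation between coordinates, its translation part being zero. In dimensions
one and two this contradicts the bijectivity of `δ` at once. In dimensions three and four the
relations leave families of commutators whose linear part depends linearly on a parameter and whose
last translation coordinate depends on it quadratically. Commutators with equal linear parts
coincide, so by `eq_of_forall_mul_eq_sq_mul` a certain additive matrix entry takes only one nonzero
value. Elements with prescribed last coordinate then collide, unless the field has two elements
(`TriCoords.eq_one`).

In dimension four and characteristic two there is a central involution `z`. A basis adapted to `ρ z
- 1` and `δ z` makes the last superdiagonal entry equal to the first translation coordinate, and
these coordinates are contradictory over every field (`CentralCoords.false`). -/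

/-- If the quadratic coefficient were nonzero, every nonzero `w` would equal `1`, in particular `α`
and `β`. Thus the field with two elements needs no separate treatment. -/
lemma eq_of_forall_mul_eq_sq_mul {F : Type*} [Field F] {α β k : F} (hα : α ≠ 0) (hβ : β ≠ 0)
    (h : ∀ w : F, w * k = w ^ 2 * (1 / α - 1 / β)) : α = β := by
  by_contra hne
  have hd : 1 / α - 1 / β ≠ 0 := by
    intro h0
    apply hne
    simpa using sub_eq_zero.mp h0
  have h1 := h 1
  have key : ∀ w : F, w ≠ 0 → w = 1 := fun w hw ↦ by
    have := h w
    apply mul_left_cancel₀ hw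
    apply mul_right_cancel₀ hd
    linear_combination -this + w * h1
  exact hne ((key α hα).trans (key β hβ).symm)

/-! ### Dimension four, characteristic two: the contradiction in coordinates -/

/-- Coordinates of a group acting by unitriangular affine maps on a four-dimensional space, simply
transitively and with faithful linear part, where the last superdiagonal entry of the linear part
is the first coordinate of the translation part. -/
structure CentralCoords (G F : Type*) [Group G] [Field F] where
  (x₁ x₂ x₃ x₄ a₁₂ a₁₃ a₁₄ a₂₃ a₂₄ : G → F)
  x₁_mul : ∀ g h, x₁ (g * h) = x₁ g + x₁ h
  x₂_mul : ∀ g h, x₂ (g * h) = x₂ g + x₁ h * a₁₂ g + x₂ h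
  x₃_mul : ∀ g h, x₃ (g * h) = x₃ g + x₁ h * a₁₃ g + x₂ h * a₂₃ g + x₃ h
  x₄_mul : ∀ g h, x₄ (g * h) = x₄ g + x₁ h * a₁₄ g + x₂ h * a₂₄ g + x₃ h * x₁ g + x₄ h
  a₁₂_mul : ∀ g h, a₁₂ (g * h) = a₁₂ g + a₁₂ h
  a₁₃_mul : ∀ g h, a₁₃ (g * h) = a₁₃ g + a₁₂ h * a₂₃ g + a₁₃ h
  a₁₄_mul : ∀ g h, a₁₄ (g * h) = a₁₄ g + a₁₂ h * a₂₄ g + a₁₃ h * x₁ g + a₁₄ h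
  a₂₃_mul : ∀ g h, a₂₃ (g * h) = a₂₃ g + a₂₃ h
  a₂₄_mul : ∀ g h, a₂₄ (g * h) = a₂₄ g + a₂₃ h * x₁ g + a₂₄ h
  surj : ∀ p q r s, ∃ g, x₁ g = p ∧ x₂ g = q ∧ x₃ g = r ∧ x₄ g = s
  faithful : ∀ g, x₁ g = 0 → a₁₂ g = 0 → a₁₃ g = 0 → a₁₄ g = 0 → a₂₃ g = 0 → a₂₄ g = 0 → g = 1

namespace CentralCoords

variable {G F : Type*} [Group G] [Field F] (D : CentralCoords G F)

lemma at_one : D.x₁ 1 = 0 ∧ D.x₂ 1 = 0 ∧ D.x₃ 1 = 0 ∧ D.x₄ 1 = 0 ∧ D.a₁₂ 1 = 0 ∧ D.a₁₃ 1 = 0 ∧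
    D.a₁₄ 1 = 0 ∧ D.a₂₃ 1 = 0 ∧ D.a₂₄ 1 = 0 := by
  have h1 := D.x₁_mul 1 1
  have h2 := D.x₂_mul 1 1
  have h3 := D.x₃_mul 1 1
  have h4 := D.x₄_mul 1 1
  have h5 := D.a₁₂_mul 1 1
  have h6 := D.a₁₃_mul 1 1
  have h7 := D.a₁₄_mul 1 1
  have h8 := D.a₂₃_mul 1 1
  have h9 := D.a₂₄_mul 1 1
  simp only [mul_one] at h1 h2 h3 h4 h5 h6 h7 h8 h9
  have e1 : D.x₁ 1 = 0 := by linear_combination -h1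
  have e5 : D.a₁₂ 1 = 0 := by linear_combination -h5
  have e8 : D.a₂₃ 1 = 0 := by linear_combination -h8
  simp only [e1, e5, e8, mul_zero, zero_mul, add_zero] at *
  have e2 : D.x₂ 1 = 0 := by linear_combination -h2
  have e6 : D.a₁₃ 1 = 0 := by linear_combination -h6
  have e9 : D.a₂₄ 1 = 0 := by linear_combination -h9
  simp only [e2, e6, e9, mul_zero, add_zero] at *
  refine ⟨trivial, trivial, ?_, ?_, trivial, trivial, ?_, trivial, trivial⟩
  · linear_combination -h3
  · linear_combination -h4
  · linear_combination -h7

/-- An element with trivial linear part has trivial translation part. -/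
lemma trivial_of_linear {g : G} (h1 : D.x₁ g = 0) (h2 : D.a₁₂ g = 0) (h3 : D.a₁₃ g = 0)
    (h4 : D.a₁₄ g = 0) (h5 : D.a₂₃ g = 0) (h6 : D.a₂₄ g = 0) :
    D.x₂ g = 0 ∧ D.x₃ g = 0 ∧ D.x₄ g = 0 := by
  obtain rfl := D.faithful g h1 h2 h3 h4 h5 h6
  obtain ⟨-, h2, h3, h4, -⟩ := D.at_one
  exact ⟨h2, h3, h4⟩

variable [CharP F 2]

/-- Elements of the subgroup `x₁ = a₁₂ = a₂₃ = 0` are determined by their linear parts. -/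
lemma eq_of_linear {g h : G} (g1 : D.x₁ g = 0) (g2 : D.a₁₂ g = 0) (g3 : D.a₂₃ g = 0)
    (h1 : D.x₁ h = 0) (h2 : D.a₁₂ h = 0) (h3 : D.a₂₃ h = 0) (e1 : D.a₁₃ g = D.a₁₃ h)
    (e2 : D.a₁₄ g = D.a₁₄ h) (e3 : D.a₂₄ g = D.a₂₄ h) : g = h := by
  have two : (2 : F) = 0 := CharTwo.two_eq_zero
  have hh : h * h = 1 := by
    apply D.faithful <;> simp only [D.x₁_mul, D.a₁₂_mul, D.a₁₃_mul, D.a₁₄_mul, D.a₂₃_mul, D.a₂₄_mul]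
      <;> grind
  have gh : g * h = 1 := by
    apply D.faithful <;> simp only [D.x₁_mul, D.a₁₂_mul, D.a₁₃_mul, D.a₁₄_mul, D.a₂₃_mul, D.a₂₄_mul]
      <;> grind
  exact mul_right_cancel (gh.trans hh.symm)

/-- The coordinates of a commutator. -/
lemma exists_comm (g h : G) : ∃ c, D.x₁ c = 0 ∧ D.a₁₂ c = 0 ∧ D.a₂₃ c = 0 ∧
    D.x₂ c = D.x₁ g * D.a₁₂ h + D.x₁ h * D.a₁₂ g ∧
    D.a₁₃ c = D.a₁₂ g * D.a₂₃ h + D.a₁₂ h * D.a₂₃ g ∧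
    D.a₂₄ c = D.a₂₃ g * D.x₁ h + D.a₂₃ h * D.x₁ g ∧
    D.x₃ c = D.x₁ g * D.a₁₃ h + D.x₂ g * D.a₂₃ h + D.x₁ h * D.a₁₃ g + D.x₂ h * D.a₂₃ g
      + D.x₂ c * (D.a₂₃ g + D.a₂₃ h) ∧
    D.a₁₄ c = D.a₁₂ g * D.a₂₄ h + D.a₁₃ g * D.x₁ h + D.a₁₂ h * D.a₂₄ g + D.a₁₃ h * D.x₁ g
      + D.a₁₃ c * (D.x₁ g + D.x₁ h) ∧
    D.x₄ c = D.x₁ g * D.a₁₄ h + D.x₂ g * D.a₂₄ h + D.x₃ g * D.x₁ h + D.x₁ h * D.a₁₄ g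
      + D.x₂ h * D.a₂₄ g + D.x₃ h * D.x₁ g + D.x₂ c * (D.a₂₄ g + D.a₂₃ h * D.x₁ g + D.a₂₄ h)
      + D.x₃ c * (D.x₁ g + D.x₁ h) := by
  have two : (2 : F) = 0 := CharTwo.two_eq_zero
  obtain ⟨c, hc⟩ : ∃ c, (g * h) * c = h * g := ⟨(g * h)⁻¹ * (h * g), by group⟩
  have h1 := congrArg D.x₁ hc
  have h2 := congrArg D.x₂ hc
  have h3 := congrArg D.x₃ hc
  have h4 := congrArg D.x₄ hc
  have h5 := congrArg D.a₁₂ hc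
  have h6 := congrArg D.a₁₃ hc
  have h7 := congrArg D.a₁₄ hc
  have h8 := congrArg D.a₂₃ hc
  have h9 := congrArg D.a₂₄ hc
  simp only [D.x₁_mul, D.x₂_mul, D.x₃_mul, D.x₄_mul, D.a₁₂_mul, D.a₁₃_mul, D.a₁₄_mul, D.a₂₃_mul,
    D.a₂₄_mul] at h1 h2 h3 h4 h5 h6 h7 h8 h9
  have e1 : D.x₁ c = 0 := by linear_combination h1
  have e5 : D.a₁₂ c = 0 := by linear_combination h5
  have e8 : D.a₂₃ c = 0 := by linear_combination h8
  simp only [e1, e5, e8, zero_mul, add_zero] at h2 h3 h4 h6 h7 h9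
  refine ⟨c, e1, e5, e8, ?_, ?_, ?_, ?_, ?_, ?_⟩ <;> grind

/-- The square of `g` has trivial linear part, and the product is its last translation coordinate.
-/
lemma x₂_mul_a₂₄_eq_zero {g : G} (h1 : D.x₁ g = 0) (h2 : D.a₁₂ g = 0) (h3 : D.a₂₃ g = 0) :
    D.x₂ g * D.a₂₄ g = 0 := by
  have two : (2 : F) = 0 := CharTwo.two_eq_zero
  have key := D.trivial_of_linear (g := g * g)
  simp only [D.x₁_mul, D.x₂_mul, D.x₃_mul, D.x₄_mul, D.a₁₂_mul, D.a₁₃_mul, D.a₁₄_mul, D.a₂₃_mul,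
    D.a₂₄_mul, h1, h2, h3, zero_mul, mul_zero, add_zero, forall_const] at key
  grind

/-- The commutator of `g` and `h` has trivial linear part; compare its last translation coordinate
with zero. -/
lemma x₂_mul_a₂₄_symm {g h : G} (g1 : D.x₁ g = 0) (g2 : D.a₁₂ g = 0) (g3 : D.a₂₃ g = 0)
    (h1 : D.x₁ h = 0) (h2 : D.a₁₂ h = 0) (h3 : D.a₂₃ h = 0) :
    D.x₂ g * D.a₂₄ h = D.x₂ h * D.a₂₄ g := by
  obtain ⟨c, c1, c2, c3, c4, c5, c6, c7, c8, c9⟩ := D.exists_comm g h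
  have two : (2 : F) = 0 := CharTwo.two_eq_zero
  have key := D.trivial_of_linear (g := c)
  simp only [g1, g2, g3, h1, h2, h3, zero_mul, mul_zero, add_zero] at c4 c5 c6 c7 c8 c9
  grind

/-- Double commutators are trivial, which forces a relation for simple commutators. -/
lemma x₂_mul_a₂₃ {g : G} (g1 : D.x₁ g = 0) (g2 : D.a₁₂ g = 0) (g3 : D.a₂₃ g = 0) (h : G) :
    D.x₂ g * D.a₂₃ h = D.a₁₂ h * D.a₂₄ g := by
  have two : (2 : F) = 0 := CharTwo.two_eq_zero
  obtain ⟨c, c1, c2, c3, c4, c5, c6, c7, c8, c9⟩ := D.exists_comm g h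
  simp only [g1, g2, g3, zero_mul, mul_zero, add_zero, zero_add] at c4 c5 c6 c7 c8 c9
  obtain ⟨k, hk, -⟩ := D.surj 1 0 0 0
  obtain ⟨d, d1, d2, d3, d4, d5, d6, d7, d8, d9⟩ := D.exists_comm c k
  simp only [c1, c2, c3, c4, c5, c6, hk, zero_mul, mul_zero, add_zero, zero_add, one_mul,
    mul_one] at d4 d5 d6 d7 d8 d9
  simp only [d4, d5, d7, zero_mul, add_zero] at d8 d9
  obtain ⟨-, -, e⟩ := D.trivial_of_linear d1 d2 d5 d8 d3 d6
  grind

/-- Suppose `x₂` is zero on the subgroup `x₁ = a₁₂ = a₂₃ = 0`. If `a₂₄` is zero there too, commuting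
with an element of `x₁ = 1` shows that an element with `x₁ = 0`, `x₂ = 1` lies in the subgroup.
Otherwise `x₂_mul_a₂₃` kills `a₁₂` everywhere, and commuting with such an element kills `a₂₄` on the
subgroup. -/
lemma exists_x₂_ne_zero : ∃ g, D.x₁ g = 0 ∧ D.a₁₂ g = 0 ∧ D.a₂₃ g = 0 ∧ D.x₂ g ≠ 0 := by
  have two : (2 : F) = 0 := CharTwo.two_eq_zero
  by_contra! hx
  by_cases ha : ∀ g, D.x₁ g = 0 → D.a₁₂ g = 0 → D.a₂₃ g = 0 → D.a₂₄ g = 0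
  · obtain ⟨k, hk, -⟩ := D.surj 1 0 0 0
    obtain ⟨g, g1, g2, -⟩ := D.surj 0 1 0 0
    obtain ⟨c, c1, c2, c3, c4, c5, c6, -⟩ := D.exists_comm g k
    have e1 := hx c c1 c2 c3
    have e2 := ha c c1 c2 c3
    simp only [g1, hk, one_mul, zero_mul, mul_one, mul_zero, zero_add, add_zero] at c4 c6
    have := hx g g1 (c4.symm.trans e1) (c6.symm.trans e2)
    simp [this] at g2
  · push Not at ha
    obtain ⟨g, g1, g2, g3, g4⟩ := ha
    have h12 : ∀ h, D.a₁₂ h = 0 := fun h ↦ by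
      have := D.x₂_mul_a₂₃ g1 g2 g3 h
      rw [hx g g1 g2 g3, zero_mul] at this
      exact (mul_eq_zero.mp this.symm).resolve_right g4
    obtain ⟨h, h1, h2, -⟩ := D.surj 0 1 0 0
    obtain ⟨c, c1, c2, c3, c4, c5, c6, c7, c8, c9⟩ := D.exists_comm g h
    have := hx g g1 g2 g3
    simp only [g1, g3, h1, h2, h12, this, one_mul, zero_mul, mul_zero, add_zero, zero_add]
      at c4 c5 c6 c7 c8 c9
    simp only [c4, zero_mul, add_zero] at c9
    obtain ⟨-, -, e⟩ := D.trivial_of_linear c1 c2 c5 c8 c3 c6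
    exact g4 (c9.symm.trans e)

lemma a₂₄_eq_zero_of_mem {g : G} (g1 : D.x₁ g = 0) (g2 : D.a₁₂ g = 0) (g3 : D.a₂₃ g = 0) :
    D.a₂₄ g = 0 := by
  obtain ⟨k, k1, k2, k3, k4⟩ := D.exists_x₂_ne_zero
  have h1 := D.x₂_mul_a₂₄_eq_zero k1 k2 k3
  have h2 := D.x₂_mul_a₂₄_symm k1 k2 k3 g1 g2 g3
  simp_all

lemma a₂₃_eq_zero (h : G) : D.a₂₃ h = 0 := by
  obtain ⟨k, k1, k2, k3, k4⟩ := D.exists_x₂_ne_zero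
  have := D.x₂_mul_a₂₃ k1 k2 k3 h
  rw [D.a₂₄_eq_zero_of_mem k1 k2 k3] at this
  simp_all

/-- The commutator of `k` and `h` has trivial linear part and last translation coordinate `x₂ k *
a₂₄ h`. -/
lemma a₂₄_eq_zero {h : G} (h1 : D.x₁ h = 0) : D.a₂₄ h = 0 := by
  obtain ⟨k, k1, k2, k3, k4⟩ := D.exists_x₂_ne_zero
  have k5 := D.a₂₄_eq_zero_of_mem k1 k2 k3
  have h23 := D.a₂₃_eq_zero h
  obtain ⟨c, c1, c2, c3, c4, c5, c6, c7, c8, c9⟩ := D.exists_comm k h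
  simp only [k1, k2, k3, k5, h1, h23, zero_mul, mul_zero, add_zero, zero_add] at *
  simp only [c4, zero_mul, add_zero] at c9
  obtain ⟨-, -, e⟩ := D.trivial_of_linear c1 c2 c5 c8 c3 c6
  exact (mul_eq_zero.mp (c9.symm.trans e)).resolve_left k4

/-- Commutators with an element of the kernel of `x₁`. -/
lemma exists_comm_of_x₁_eq_zero {g : G} (g1 : D.x₁ g = 0) (h : G) : ∃ c, D.x₁ c = 0 ∧
    D.a₁₂ c = 0 ∧ D.a₁₃ c = 0 ∧ D.a₁₄ c = D.a₁₂ g * D.a₂₄ h + D.a₁₃ g * D.x₁ h ∧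
    D.x₂ c = D.x₁ h * D.a₁₂ g ∧ D.x₃ c = D.x₁ h * D.a₁₃ g ∧
    D.x₄ c = D.x₂ g * D.a₂₄ h + D.x₃ g * D.x₁ h + D.x₁ h * D.a₁₄ g
      + D.x₁ h * D.a₁₂ g * D.a₂₄ h + D.x₁ h * D.a₁₃ g * D.x₁ h := by
  obtain ⟨c, c1, c2, c3, c4, c5, c6, c7, c8, c9⟩ := D.exists_comm g h
  have g24 := D.a₂₄_eq_zero g1
  simp only [g1, g24, D.a₂₃_eq_zero, zero_mul, mul_zero, add_zero, zero_add] at *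
  rw [c4, c7] at c9
  exact ⟨c, c1, c2, c5, by rw [c8, c5]; ring, c4, c7, c9⟩

lemma eq_of_x₁_eq_zero {g h : G} (g1 : D.x₁ g = 0) (g2 : D.a₁₂ g = 0) (g3 : D.a₁₃ g = 0)
    (h1 : D.x₁ h = 0) (h2 : D.a₁₂ h = 0) (h3 : D.a₁₃ h = 0) (e : D.a₁₄ g = D.a₁₄ h) : g = h :=
  D.eq_of_linear g1 g2 (D.a₂₃_eq_zero g) h1 h2 (D.a₂₃_eq_zero h) (g3.trans h3.symm) e
    ((D.a₂₄_eq_zero g1).trans (D.a₂₄_eq_zero h1).symm)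

lemma relation_of_a₁₃_eq_zero {g : G} (g1 : D.x₁ g = 0) (g2 : D.a₁₂ g = 0) (g3 : D.a₁₃ g = 0)
    (h : G) : D.x₂ g * D.a₂₄ h + D.x₃ g * D.x₁ h + D.x₁ h * D.a₁₄ g = 0 := by
  obtain ⟨c, c1, c2, c3, c4, c5, c6, c7⟩ := D.exists_comm_of_x₁_eq_zero g1 h
  simp only [g2, g3, zero_mul, mul_zero, add_zero] at *
  obtain ⟨-, -, e⟩ := D.trivial_of_linear c1 c2 c3 c4 (D.a₂₃_eq_zero c) (D.a₂₄_eq_zero c1)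
  exact c7.symm.trans e

/-- The case where `a₂₄` is a multiple of `x₁`. -/
lemma a₂₄_not_mul_x₁ (l : F) : ¬ ∀ h, D.a₂₄ h = l * D.x₁ h := by
  intro hl
  have two : (2 : F) = 0 := CharTwo.two_eq_zero
  have comm : ∀ g, D.x₁ g = 0 → ∀ t, ∃ c, D.x₁ c = 0 ∧ D.a₁₂ c = 0 ∧ D.a₁₃ c = 0 ∧
      D.a₁₄ c = t * (l * D.a₁₂ g + D.a₁₃ g) ∧ D.x₂ c = t * D.a₁₂ g ∧
      D.x₄ c = t * (l * D.x₂ g + D.x₃ g + D.a₁₄ g) + t ^ 2 * (l * D.a₁₂ g + D.a₁₃ g) := by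
    intro g g1 t
    obtain ⟨h, ht, -⟩ := D.surj t 0 0 0
    obtain ⟨c, c1, c2, c3, c4, c5, c6, c7⟩ := D.exists_comm_of_x₁_eq_zero g1 h
    rw [hl, ht] at c4 c7
    rw [ht] at c5
    exact ⟨c, c1, c2, c3, by rw [c4]; ring, c5, by rw [c7]; ring⟩
  have triv : ∀ g, D.x₁ g = 0 → l * D.a₁₂ g + D.a₁₃ g = 0 → l * D.x₂ g + D.x₃ g = 0 →
      D.x₂ g = 0 ∧ D.x₃ g = 0 ∧ D.x₄ g = 0 := by
    intro g g1 g2 g3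
    obtain ⟨c, c1, c2, c3, c4, c5, -⟩ := comm g g1 1
    rw [g2, mul_zero] at c4
    obtain ⟨e, -, -⟩ := D.trivial_of_linear c1 c2 c3 c4 (D.a₂₃_eq_zero c) (D.a₂₄_eq_zero c1)
    have g4 : D.a₁₂ g = 0 := by simpa using c5.symm.trans e
    have g5 : D.a₁₃ g = 0 := by simpa [g4] using g2
    obtain ⟨k, hk, -⟩ := D.surj 1 0 0 0
    have r := D.relation_of_a₁₃_eq_zero g1 g4 g5 k
    rw [hl, hk] at r
    exact D.trivial_of_linear g1 g4 g5 (by linear_combination r - g3) (D.a₂₃_eq_zero g)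
      (D.a₂₄_eq_zero g1)
  -- The parameters `w / α` and `w / β` give two commutators with `a₁₄ = w`, hence equal; their `x₄`
  -- are quadratic in `w` with leading coefficients `1 / α` and `1 / β`.
  have const : ∀ g g', D.x₁ g = 0 → D.x₁ g' = 0 → l * D.a₁₂ g + D.a₁₃ g ≠ 0 →
      l * D.a₁₂ g' + D.a₁₃ g' ≠ 0 → l * D.a₁₂ g + D.a₁₃ g = l * D.a₁₂ g' + D.a₁₃ g' := by
    intro g g' g1 g1' hα hβ
    refine eq_of_forall_mul_eq_sq_mul (k := (l * D.x₂ g' + D.x₃ g' + D.a₁₄ g') /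
      (l * D.a₁₂ g' + D.a₁₃ g') - (l * D.x₂ g + D.x₃ g + D.a₁₄ g) / (l * D.a₁₂ g + D.a₁₃ g))
      hα hβ fun w ↦ ?_
    obtain ⟨c, c1, c2, c3, c4, -, c5⟩ := comm g g1 (w / (l * D.a₁₂ g + D.a₁₃ g))
    obtain ⟨d, d1, d2, d3, d4, -, d5⟩ := comm g' g1' (w / (l * D.a₁₂ g' + D.a₁₃ g'))
    rw [div_mul_cancel₀ _ hα] at c4
    rw [div_mul_cancel₀ _ hβ] at d4
    obtain rfl := D.eq_of_x₁_eq_zero c1 c2 c3 d1 d2 d3 (c4.trans d4.symm)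
    have e := c5.symm.trans d5
    set α := l * D.a₁₂ g + D.a₁₃ g
    set β := l * D.a₁₂ g' + D.a₁₃ g'
    have eα : (w / α) ^ 2 * α = w ^ 2 * (1 / α) := by field_simp
    have eβ : (w / β) ^ 2 * β = w ^ 2 * (1 / β) := by field_simp
    rw [eα, eβ] at e
    linear_combination -e
  -- The coordinate `-l` makes `l * x₂ + x₃` vanish, as `triv` requires.
  obtain ⟨g, g1, g2, g3, g4⟩ := D.surj 0 1 (-l) 0
  obtain ⟨h, h1, h2, h3, h4⟩ := D.surj 0 0 0 1
  have hg : l * D.a₁₂ g + D.a₁₃ g ≠ 0 := fun h0 ↦ by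
    have := (triv g g1 h0 (by rw [g2, g3]; ring)).1
    simp [g2] at this
  have hh : l * D.a₁₂ h + D.a₁₃ h ≠ 0 := fun h0 ↦ by
    have := (triv h h1 h0 (by rw [h2, h3]; ring)).2.2
    simp [h4] at this
  have e := const g h g1 h1 hg hh
  -- The entry `l * a₁₂ + a₁₃` is additive, so its equal values at `g` and `h` cancel on `g * h`,
  -- although `x₂ (g * h) = 1`.
  have := (triv (g * h) (by rw [D.x₁_mul, g1, h1, add_zero])
    (by rw [D.a₁₂_mul, D.a₁₃_mul, D.a₂₃_eq_zero]; grind)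
    (by rw [D.x₂_mul, D.x₃_mul, g2, g3, h1, h2, h3]; ring)).1
  rw [D.x₂_mul, g2, h1, h2] at this
  simp at this

/-- There is no simply transitive group with such coordinates in characteristic two. -/
theorem false {G F : Type*} [Group G] [Field F] [CharP F 2] (D : CentralCoords G F) : False := by
  have two : (2 : F) = 0 := CharTwo.two_eq_zero
  have hl : ∀ l : F, ∃ h, D.a₂₄ h ≠ l * D.x₁ h := fun l ↦ by
    simpa using D.a₂₄_not_mul_x₁ l
  obtain ⟨k, hk, -⟩ := D.surj 1 0 0 0
  -- The relation between the commutator of `g`, `h` and the element `k` reads `a₁₂ g * (a₂₄ h + a₂₄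
  -- k * x₁ h) = 0`.
  have h12 : ∀ g, D.x₁ g = 0 → D.a₁₂ g = 0 := by
    intro g g1
    by_contra hg
    obtain ⟨h, hh⟩ := hl (D.a₂₄ k)
    obtain ⟨c, c1, c2, c3, c4, c5, c6, -⟩ := D.exists_comm_of_x₁_eq_zero g1 h
    have r := D.relation_of_a₁₃_eq_zero c1 c2 c3 k
    rw [hk, c4, c5, c6] at r
    apply hh
    apply mul_left_cancel₀ hg
    grind
  -- If `x₂ g` were nonzero, the relation would make `a₂₄` a multiple of `x₁`.
  have h13 : ∀ g, D.x₁ g = 0 → D.a₁₃ g = 0 → D.x₂ g = 0 ∧ D.a₁₄ g = D.x₃ g := by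
    intro g g1 g2
    have r := D.relation_of_a₁₃_eq_zero g1 (h12 g g1) g2
    have e : D.x₂ g = 0 := by
      by_contra h0
      obtain ⟨h, hh⟩ := hl ((D.x₃ g + D.a₁₄ g) / D.x₂ g)
      apply hh
      apply mul_left_cancel₀ h0
      field_simp
      linear_combination r h - (D.x₃ g + D.a₁₄ g) * D.x₁ h * two
    have := r k
    rw [e, hk] at this
    exact ⟨e, by linear_combination this - D.x₃ g * two⟩
  have const : ∀ g g', D.x₁ g = 0 → D.x₁ g' = 0 → D.x₂ g = 0 → D.x₂ g' = 0 → D.a₁₃ g ≠ 0 →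
      D.a₁₃ g' ≠ 0 → D.a₁₃ g = D.a₁₃ g' := by
    intro g g' g1 g1' g2 g2' hα hβ
    refine eq_of_forall_mul_eq_sq_mul (k := (D.x₃ g' + D.a₁₄ g') / D.a₁₃ g' -
      (D.x₃ g + D.a₁₄ g) / D.a₁₃ g) hα hβ fun w ↦ ?_
    obtain ⟨h, hh, -⟩ := D.surj (w / D.a₁₃ g) 0 0 0
    obtain ⟨h', hh', -⟩ := D.surj (w / D.a₁₃ g') 0 0 0
    obtain ⟨c, c1, c2, c3, c4, -, -, c5⟩ := D.exists_comm_of_x₁_eq_zero g1 h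
    obtain ⟨d, d1, d2, d3, d4, -, -, d5⟩ := D.exists_comm_of_x₁_eq_zero g1' h'
    rw [h12 _ g1, zero_mul, zero_add, hh, mul_div_cancel₀ _ hα] at c4
    rw [h12 _ g1', zero_mul, zero_add, hh', mul_div_cancel₀ _ hβ] at d4
    obtain rfl := D.eq_of_x₁_eq_zero c1 c2 c3 d1 d2 d3 (c4.trans d4.symm)
    have e := c5.symm.trans d5
    rw [h12 _ g1, h12 _ g1', g2, g2', hh, hh'] at e
    set α := D.a₁₃ g
    set β := D.a₁₃ g'
    have eα : w / α * α * (w / α) = w ^ 2 * (1 / α) := by field_simp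
    have eβ : w / β * β * (w / β) = w ^ 2 * (1 / β) := by field_simp
    rw [eα, eβ] at e
    linear_combination -e
  have triv : ∀ g, D.x₁ g = 0 → D.x₃ g = 0 → D.a₁₃ g = 0 → D.x₄ g = 0 := fun g g1 g2 g3 ↦
    (D.trivial_of_linear g1 (h12 g g1) g3 ((h13 g g1 g3).2.trans g2) (D.a₂₃_eq_zero g)
      (D.a₂₄_eq_zero g1)).2.2
  have card : ∀ s : F, s ≠ 0 → s = 1 := by
    intro s hs
    obtain ⟨g, g1, g2, g3, g4⟩ := D.surj 0 0 0 s
    obtain ⟨h, h1, h2, h3, h4⟩ := D.surj 0 0 0 1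
    have e := const g h g1 h1 g2 h2 (fun h0 ↦ hs (g4 ▸ triv g g1 g3 h0))
      (fun h0 ↦ one_ne_zero (h4 ▸ triv h h1 h3 h0))
    have := triv (g * h) (by rw [D.x₁_mul, g1, h1, add_zero])
      (by rw [D.x₃_mul, g3, h1, h2, h3]; ring)
      (by rw [D.a₁₃_mul, D.a₂₃_eq_zero]; grind)
    rw [D.x₄_mul, g4, h1, h2, h3, h4] at this
    linear_combination this - two
  -- Now `F` has two elements, so `x₁ h` is `0` or `1`; either way `a₂₄ h = a₂₄ k * x₁ h`.
  obtain ⟨h, hh⟩ := hl (D.a₂₄ k)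
  by_cases h1 : D.x₁ h = 0
  · rw [h1, D.a₂₄_eq_zero h1] at hh
    simp at hh
  · have h1 := card _ h1
    have : D.a₂₄ (h * k) = 0 := D.a₂₄_eq_zero (by rw [D.x₁_mul, h1, hk]; linear_combination two)
    rw [D.a₂₄_mul, D.a₂₃_eq_zero] at this
    rw [h1] at hh
    apply hh
    linear_combination this - D.a₂₄ k * two

end CentralCoords

/-! ### Dimension three in coordinates -/

/-- Coordinates of a group acting by unitriangular affine maps on a three-dimensional space, simply
transitively and with faithful linear part. -/
structure TriCoords (G F : Type*) [Group G] [Field F] where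
  (x y z a b c : G → F)
  x_mul : ∀ g h, x (g * h) = x g + x h
  y_mul : ∀ g h, y (g * h) = y g + x h * a g + y h
  z_mul : ∀ g h, z (g * h) = z g + x h * c g + y h * b g + z h
  a_mul : ∀ g h, a (g * h) = a g + a h
  b_mul : ∀ g h, b (g * h) = b g + b h
  c_mul : ∀ g h, c (g * h) = c g + a h * b g + c h
  surj : ∀ p q r, ∃ g, x g = p ∧ y g = q ∧ z g = r
  faithful : ∀ g, a g = 0 → b g = 0 → c g = 0 → g = 1

namespace TriCoords

variable {G F : Type*} [Group G] [Field F] (D : TriCoords G F)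

lemma at_one : D.x 1 = 0 ∧ D.y 1 = 0 ∧ D.z 1 = 0 ∧ D.a 1 = 0 ∧ D.b 1 = 0 ∧ D.c 1 = 0 := by
  have h1 := D.x_mul 1 1
  have h2 := D.y_mul 1 1
  have h3 := D.z_mul 1 1
  have h4 := D.a_mul 1 1
  have h5 := D.b_mul 1 1
  have h6 := D.c_mul 1 1
  simp only [mul_one] at h1 h2 h3 h4 h5 h6
  have e1 : D.x 1 = 0 := by linear_combination -h1
  have e4 : D.a 1 = 0 := by linear_combination -h4
  have e5 : D.b 1 = 0 := by linear_combination -h5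
  simp only [e1, e4, e5, mul_zero, zero_mul, add_zero] at *
  exact ⟨trivial, by linear_combination -h2, by linear_combination -h3, trivial, trivial,
    by linear_combination -h6⟩

lemma trivial_of_linear {g : G} (h1 : D.a g = 0) (h2 : D.b g = 0) (h3 : D.c g = 0) :
    D.x g = 0 ∧ D.y g = 0 ∧ D.z g = 0 := by
  obtain rfl := D.faithful g h1 h2 h3
  obtain ⟨h1, h2, h3, -⟩ := D.at_one
  exact ⟨h1, h2, h3⟩

/-- The coordinates of a commutator. -/
lemma exists_comm (g h : G) : ∃ k, D.x k = 0 ∧ D.a k = 0 ∧ D.b k = 0 ∧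
    D.y k = D.x g * D.a h - D.x h * D.a g ∧ D.c k = D.a g * D.b h - D.a h * D.b g ∧
    D.z k = D.x g * D.c h + D.y g * D.b h - (D.x h * D.c g + D.y h * D.b g)
      - D.y k * (D.b g + D.b h) := by
  obtain ⟨k, hk⟩ : ∃ k, (g * h) * k = h * g := ⟨(g * h)⁻¹ * (h * g), by group⟩
  have h1 := congrArg D.x hk
  have h2 := congrArg D.y hk
  have h3 := congrArg D.z hk
  have h4 := congrArg D.a hk
  have h5 := congrArg D.b hk
  have h6 := congrArg D.c hk
  simp only [D.x_mul, D.y_mul, D.z_mul, D.a_mul, D.b_mul, D.c_mul] at h1 h2 h3 h4 h5 h6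
  have e1 : D.x k = 0 := by linear_combination h1
  have e4 : D.a k = 0 := by linear_combination h4
  have e5 : D.b k = 0 := by linear_combination h5
  rw [e1] at h2 h3
  rw [e4] at h6
  have e2 : D.y k = D.x g * D.a h - D.x h * D.a g := by linear_combination h2
  have e6 : D.c k = D.a g * D.b h - D.a h * D.b g := by linear_combination h6
  exact ⟨k, e1, e4, e5, e2, e6, by linear_combination h3⟩

lemma eq_of_a_b_c {g h : G} (e1 : D.a g = D.a h) (e2 : D.b g = D.b h) (e3 : D.c g = D.c h) :
    g = h := by
  obtain ⟨k, hk⟩ : ∃ k, g * k = h := ⟨g⁻¹ * h, by group⟩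
  have h4 := congrArg D.a hk
  have h5 := congrArg D.b hk
  have h6 := congrArg D.c hk
  simp only [D.a_mul, D.b_mul, D.c_mul] at h4 h5 h6
  have e4 : D.a k = 0 := by linear_combination h4 - e1
  rw [e4] at h6
  have := D.faithful k e4 (by linear_combination h5 - e2) (by linear_combination h6 - e3)
  rw [← hk, this, mul_one]

/-- The commutator of `t` and `h` has trivial linear part; the relation is the vanishing of its `z`.
-/
lemma x_mul_c {t : G} (t1 : D.x t = 0) (t2 : D.a t = 0) (t3 : D.b t = 0) (h : G) :
    D.x h * D.c t = D.y t * D.b h := by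
  obtain ⟨k, k1, k2, k3, k4, k5, k6⟩ := D.exists_comm t h
  simp only [t1, t2, t3, zero_mul, mul_zero, sub_zero, zero_add, add_zero] at k4 k5 k6
  obtain ⟨-, -, e⟩ := D.trivial_of_linear k2 k3 k5
  rw [k4] at k6
  linear_combination k6 - e

/-- Otherwise every element with `x = y = 0` is trivial: its commutator with `v` is trivial, which
gives `b = 0`, and then `x_mul_c` with `u` gives `c = 0`. But `z` is arbitrary on these elements. -/
lemma exists_a_ne_zero : ∃ g, D.x g = 0 ∧ D.y g = 0 ∧ D.a g ≠ 0 := by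
  by_contra! ha
  obtain ⟨u, hu, -⟩ := D.surj 1 0 0
  obtain ⟨v, v1, v2, -⟩ := D.surj 0 1 0
  have key : ∀ g, D.x g = 0 → D.y g = 0 → D.b g = 0 → g = 1 := fun g g1 g2 g3 ↦ by
    have := D.x_mul_c g1 (ha g g1 g2) g3 u
    rw [g2, hu] at this
    exact D.faithful g (ha g g1 g2) g3 (by linear_combination this)
  have hb : ∀ g, D.x g = 0 → D.y g = 0 → g = 1 := fun g g1 g2 ↦ by
    have g3 := ha g g1 g2
    obtain ⟨k, k1, k2, k3, k4, k5, k6⟩ := D.exists_comm g v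
    have k7 := key k k1 (by rw [k4, g1, g3]; ring) k3
    rw [k7, D.at_one.2.1, D.at_one.2.2.1, g1, g2, v1, v2] at k6
    exact key g g1 g2 (by linear_combination k6)
  obtain ⟨g, g1, g2, g3⟩ := D.surj 0 0 1
  rw [hb g g1 g2, D.at_one.2.2.1] at g3
  exact zero_ne_one g3

/-- Such coordinates exist at most over the field with two elements. -/
theorem eq_one {G F : Type*} [Group G] [Field F] (D : TriCoords G F) (t : F)
    (ht : t ≠ 0) : t = 1 := by
  obtain ⟨g₀, g01, g02, g03⟩ := D.exists_a_ne_zero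
  obtain ⟨u, hu, -⟩ := D.surj 1 0 0
  -- The commutator of `g₀` and `u` has `x = a = b = 0` and `y ≠ 0`, so `x_mul_c` makes `b`
  -- proportional to `x`.
  obtain ⟨l, hl0, hl⟩ : ∃ l : F, l ≠ 0 ∧ ∀ h, D.b h = l * D.x h := by
    obtain ⟨k, k1, k2, k3, k4, k5, k6⟩ := D.exists_comm g₀ u
    have hy : D.y k ≠ 0 := by rw [k4, g01, hu]; simpa using g03
    refine ⟨D.c k / D.y k, fun h0 ↦ hy ?_, fun h ↦ ?_⟩
    · have := (div_eq_zero_iff.mp h0).resolve_right hy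
      exact (D.trivial_of_linear k2 k3 this).2.1
    · field_simp
      linear_combination -D.x_mul_c k1 k2 k3 h
  have hc : ∀ k, D.x k = 0 → D.a k = 0 → D.c k = l * D.y k := fun k k1 k2 ↦ by
    have := D.x_mul_c k1 k2 (by rw [hl, k1, mul_zero]) u
    rw [hl u, hu] at this
    linear_combination this
  have comm : ∀ n w, D.x n = 0 → ∃ k, D.x k = 0 ∧ D.a k = 0 ∧ D.b k = 0 ∧ D.y k = w * D.a n ∧
      D.c k = -(l * w * D.a n) ∧ D.z k = w * D.c n - l * w * D.y n - l * w ^ 2 * D.a n := by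
    intro n w hn
    obtain ⟨h, hh, -⟩ := D.surj w 0 0
    obtain ⟨k, k1, k2, k3, k4, k5, k6⟩ := D.exists_comm h n
    rw [k4] at k6
    simp only [hl, hn, hh, mul_zero, zero_mul, add_zero, zero_add, sub_zero, zero_sub] at k4 k5 k6
    exact ⟨k, k1, k2, k3, k4, by rw [k5]; ring, by rw [k6]; ring⟩
  have const : ∀ g, D.x g = 0 → D.a g ≠ 0 → D.a g = D.a g₀ := by
    intro g g1 hβ
    refine eq_of_forall_mul_eq_sq_mul (k := (1 / l) * ((D.c g - l * D.y g) / D.a g -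
      (D.c g₀ - l * D.y g₀) / D.a g₀)) hβ g03 fun w ↦ ?_
    obtain ⟨k, k1, k2, k3, -, k4, k5⟩ := comm g (w / D.a g) g1
    obtain ⟨k', k1', k2', k3', -, k4', k5'⟩ := comm g₀ (w / D.a g₀) g01
    rw [mul_assoc, div_mul_cancel₀ _ hβ] at k4
    rw [mul_assoc, div_mul_cancel₀ _ g03] at k4'
    obtain rfl := D.eq_of_a_b_c (k2.trans k2'.symm) (k3.trans k3'.symm) (k4.trans k4'.symm)
    have e := k5.symm.trans k5'
    field_simp at e ⊢
    linear_combination e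
  obtain ⟨p, p1, p2, p3⟩ := D.surj 0 0 t
  obtain ⟨q, q1, q2, q3⟩ := D.surj 0 0 1
  have triv : ∀ g, D.x g = 0 → D.y g = 0 → D.a g = 0 → D.z g = 0 := fun g g1 g2 g3 ↦
    (D.trivial_of_linear g3 (by rw [hl, g1, mul_zero]) (by rw [hc g g1 g3, g2, mul_zero])).2.2
  have hp := const p p1 fun h0 ↦ ht (p3 ▸ triv p p1 p2 h0)
  have hq := const q q1 fun h0 ↦ one_ne_zero (q3 ▸ triv q q1 q2 h0)
  -- Since `a p = a q`, the quotient has `x = y = a = 0`, hence `z = 0`; but its `z` is `t - 1`.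
  obtain ⟨k, hk⟩ : ∃ k, q * k = p := ⟨q⁻¹ * p, by group⟩
  have h1 := congrArg D.x hk
  have h2 := congrArg D.y hk
  have h3 := congrArg D.z hk
  have h4 := congrArg D.a hk
  simp only [D.x_mul, D.y_mul, D.z_mul, D.a_mul] at h1 h2 h3 h4
  have e1 : D.x k = 0 := by linear_combination h1 - q1 + p1
  rw [e1] at h2 h3
  have e2 : D.y k = 0 := by linear_combination h2 - q2 + p2
  rw [e2] at h3
  have := triv k e1 e2 (by linear_combination h4 - hq + hp)
  linear_combination this - h3 - p3 + q3

end TriCoords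

/-! ### Kolchin's theorem and unitriangular bases -/

open Module in
/-- The trace form on the endomorphisms of a finite-dimensional space is nondegenerate. -/
lemma LinearMap.eq_zero_of_trace_mul_eq_zero {k V : Type*} [Field k] [AddCommGroup V] [Module k V]
    [FiniteDimensional k V] {f : End k V} (h : ∀ x : End k V, trace k V (f * x) = 0) : f = 0 := by
  let b := finBasis k V
  apply (toMatrix b b).injective
  rw [Matrix.ext_iff_trace_mul_right]
  intro x
  have := h (Matrix.toLin b b x)
  rw [trace_eq_matrix_trace k b, Module.End.mul_eq_comp, toMatrix_comp b b b,
    toMatrix_toLin] at this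
  simpa using this

open Module in
/-- Unipotent elements spanning an algebra over an algebraically closed field act trivially on
simple modules, if they form a monoid. -/
theorem IsSimpleModule.smul_eq_of_isNilpotent {k B G M : Type*} [Field k] [IsAlgClosed k]
    [Monoid G] [Ring B] [Algebra k B] [AddCommGroup M] [Module k M] [Module B M]
    [IsScalarTower k B M] [FiniteDimensional k M] [IsSimpleModule B M] (u : G →* B)
    (hu : Submodule.span k (Set.range u) = ⊤)
    (hn : ∀ g, ∃ n : ℕ, ∀ m : M, (u g - 1) ^ n • m = 0) (g : G) (m : M) : u g • m = m := by
  let τ : B →ₐ[k] End k M := Algebra.lsmul k k M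
  have hτ : ∀ g, IsNilpotent (τ (u g) - 1) := by
    intro g
    obtain ⟨n, hn⟩ := hn g
    refine ⟨n, LinearMap.ext fun s ↦ ?_⟩
    have e : (τ (u g) - 1) ^ n = τ ((u g - 1) ^ n) := by
      rw [map_pow, map_sub, map_one]
    rw [e]
    exact hn s
  have htr : ∀ g, LinearMap.trace k M (τ (u g)) = LinearMap.trace k M 1 := by
    intro g
    rw [← sub_eq_zero, ← map_sub]
    exact (LinearMap.isNilpotent_trace_of_isNilpotent (hτ g)).eq_zero
  -- All `τ (u g)` have the same trace, so `τ (u g) - 1` is orthogonal to every `τ (u h)`, and to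
  -- their span, under the trace form.
  have htr' : ∀ g r, LinearMap.trace k M ((τ (u g) - 1) * τ r) = 0 := by
    intro g r
    have hr : r ∈ Submodule.span k (Set.range u) := hu ▸ Submodule.mem_top
    induction hr using Submodule.span_induction with
    | mem r hr =>
      obtain ⟨h, rfl⟩ := hr
      rw [sub_mul, one_mul, ← map_mul, ← map_mul, map_sub, htr, htr, sub_self]
    | zero => simp
    | add a b _ _ ha hb => rw [map_add, mul_add, map_add, ha, hb, add_zero]
    | smul c a _ ha => rw [map_smul, mul_smul_comm, map_smul, ha, smul_zero]
  -- Burnside's theorem: the commutant of a simple module consists of scalars, so density applies to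
  -- every `k`-linear map.
  have hsurj : Function.Surjective τ := by
    intro f
    have hk := (IsSimpleModule.algebraMap_end_bijective_of_isAlgClosed (A := B) (V := M) k).2
    let f' : End (End B M) M :=
      { toFun := f
        map_add' := map_add f
        map_smul' := fun c s ↦ by
          obtain ⟨c, rfl⟩ := hk c
          simp }
    obtain ⟨s, hs⟩ := (Module.Finite.fg_top : (⊤ : Submodule k M).FG)
    obtain ⟨r, hr⟩ := jacobson_density f' s
    refine ⟨r, LinearMap.ext_on hs fun m hm ↦ (hr m hm).symm⟩
  have : τ (u g) - 1 = 0 := by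
    refine LinearMap.eq_zero_of_trace_mul_eq_zero fun x ↦ ?_
    obtain ⟨r, rfl⟩ := hsurj x
    exact htr' g r
  exact congr($(sub_eq_zero.mp this) m)

/-- **Kolchin's theorem** over an algebraically closed field: a group of unipotent operators has a
nonzero fixed vector. -/
theorem Representation.exists_fixed_of_isAlgClosed {k G V : Type*} [Field k] [IsAlgClosed k]
    [Monoid G] [AddCommGroup V] [Module k V] [FiniteDimensional k V] [Nontrivial V]
    (ρ : Representation k G V) (hρ : ∀ g, IsNilpotent (ρ g - 1)) :
    ∃ v : V, v ≠ 0 ∧ ∀ g, ρ g v = v := by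
  have : FiniteDimensional k ρ.asModule := inferInstanceAs (FiniteDimensional k V)
  have : Nontrivial ρ.asModule := inferInstanceAs (Nontrivial V)
  have : IsArtinian (MonoidAlgebra k G) ρ.asModule := isArtinian_of_tower k inferInstance
  obtain ⟨S, hS⟩ := IsAtomic.exists_atom (Submodule (MonoidAlgebra k G) ρ.asModule)
  have : IsSimpleModule (MonoidAlgebra k G) S := isSimpleModule_iff_isAtom.mpr hS
  have : Nontrivial S := IsSimpleModule.nontrivial (MonoidAlgebra k G) S
  have : FiniteDimensional k S := .of_injective (S.subtype.restrictScalars k) S.injective_subtype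
  have key := IsSimpleModule.smul_eq_of_isNilpotent (k := k) (M := S) (MonoidAlgebra.of k G)
    (by
      refine eq_top_iff.mpr fun r _ ↦ ?_
      induction r using MonoidAlgebra.induction_on with
      | of h => exact Submodule.subset_span ⟨h, rfl⟩
      | add a b ha hb => exact Submodule.add_mem _ (ha Submodule.mem_top) (hb Submodule.mem_top)
      | smul c a ha => exact Submodule.smul_mem _ _ (ha Submodule.mem_top))
    (fun g ↦ by
      obtain ⟨n, hn⟩ := hρ g
      refine ⟨n, fun s ↦ Subtype.ext (ρ.asModuleEquiv.injective ?_)⟩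
      rw [Submodule.coe_smul, ρ.asModuleEquiv_map_smul, map_pow, map_sub, map_one,
        ρ.asAlgebraHom_of, hn]
      simp)
  obtain ⟨s, hs⟩ := exists_ne (0 : S)
  refine ⟨ρ.asModuleEquiv s, by simpa using hs, fun g ↦ ?_⟩
  have e := congr(ρ.asModuleEquiv (($(key g s) : S) : ρ.asModule))
  rwa [Submodule.coe_smul, ρ.asModuleEquiv_map_smul, ρ.asAlgebraHom_of] at e

/-- **Kolchin's theorem** for matrices. -/
theorem Matrix.exists_fixed_of_isNilpotent_sub_one {F G n : Type*} [Field F] [Monoid G] [Fintype n]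
    [DecidableEq n] [Nonempty n] (ρ : G →* Matrix n n F) (hρ : ∀ g, IsNilpotent (ρ g - 1)) :
    ∃ v : n → F, v ≠ 0 ∧ ∀ g, (ρ g).mulVec v = v := by
  let K := AlgebraicClosure F
  let m : Matrix n n F →+* Matrix n n K := (algebraMap F K).mapMatrix
  let τ : Representation K G (n → K) :=
    ((Matrix.toLinAlgEquiv' (R := K) (n := n) : Matrix n n K →* Module.End K (n → K)).comp
      (m : Matrix n n F →* Matrix n n K)).comp ρ
  have hτ : ∀ g, τ g = Matrix.toLinAlgEquiv' (m (ρ g)) := fun g ↦ rfl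
  obtain ⟨v, hv, hfix⟩ := τ.exists_fixed_of_isAlgClosed fun g ↦ by
    rw [hτ, ← map_one (Matrix.toLinAlgEquiv' (R := K) (n := n)), ← map_one m, ← map_sub, ← map_sub]
    exact ((hρ g).map m).map _
  obtain ⟨j, hj⟩ := Function.ne_iff.mp hv
  -- The matrices have entries in `F`, so applying an `F`-linear functional `K → F` to each
  -- coordinate turns the fixed vector over `K` into one over `F`.
  obtain ⟨l, hl⟩ := Module.Projective.exists_dual_ne_zero F (x := v j) hj
  refine ⟨fun i ↦ l (v i), fun h ↦ hl (congrFun h j), fun g ↦ funext fun i ↦ ?_⟩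
  have e := congr(l ($(hfix g) i))
  rw [hτ, Matrix.toLinAlgEquiv'_apply] at e
  rw [← e]
  simp only [Matrix.mulVec, dotProduct, map_sum]
  refine Finset.sum_congr rfl fun x _ ↦ ?_
  have : m (ρ g) i x = algebraMap F K (ρ g i x) := rfl
  rw [this, ← Algebra.smul_def, map_smul, smul_eq_mul]

/-- **Kolchin's theorem**: a group of unipotent operators has a nonzero fixed vector. -/
theorem Representation.exists_fixed_of_isNilpotent_sub_one {k G V : Type*} [Field k]
    [Monoid G] [AddCommGroup V] [Module k V] [FiniteDimensional k V] [Nontrivial V]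
    (ρ : Representation k G V) (hρ : ∀ g, IsNilpotent (ρ g - 1)) :
    ∃ v : V, v ≠ 0 ∧ ∀ g, ρ g v = v := by
  let b := Module.finBasis k V
  have : Nonempty (Fin (Module.finrank k V)) := ⟨⟨0, Module.finrank_pos⟩⟩
  let e := LinearMap.toMatrixAlgEquiv b
  obtain ⟨v, hv, hfix⟩ := Matrix.exists_fixed_of_isNilpotent_sub_one
    ((MonoidHomClass.toMonoidHom e).comp ρ) fun g ↦ by
      have := (hρ g).map e
      rwa [map_sub, map_one] at this
  refine ⟨b.equivFun.symm v, (LinearEquiv.map_ne_zero_iff _).mpr hv, fun g ↦ ?_⟩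
  apply b.equivFun.injective
  rw [LinearEquiv.apply_symm_apply]
  conv_rhs => rw [← hfix g]
  have := LinearMap.toMatrix_mulVec_repr b b (ρ g) (b.equivFun.symm v)
  have h2 : (b.repr (b.equivFun.symm v) : Fin _ → k) = v := b.equivFun.apply_symm_apply v
  rw [h2] at this
  exact this.symm

/-- A group of unipotent operators on a nonzero space has a nonzero invariant functional. -/
theorem Representation.exists_invariant_dual {k G V : Type*} [Field k]
    [Group G] [AddCommGroup V] [Module k V] [FiniteDimensional k V] [Nontrivial V]
    (ρ : Representation k G V) (hρ : ∀ g, IsNilpotent (ρ g - 1)) :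
    ∃ f : Module.Dual k V, f ≠ 0 ∧ ∀ g v, f (ρ g v) = f v := by
  obtain ⟨f, hf, h⟩ := ρ.dual.exists_fixed_of_isNilpotent_sub_one fun g ↦ by
    obtain ⟨n, hn⟩ := hρ g⁻¹
    have e : ∀ n (f : Module.Dual k V), ((ρ.dual g - 1) ^ n) f = f ∘ₗ ((ρ g⁻¹ - 1) ^ n) := by
      intro n
      induction n with
      | zero => intro f; rfl
      | succ n ih =>
        intro f
        rw [pow_succ, Module.End.mul_apply, ih, pow_succ', Module.End.mul_eq_comp,
          ← LinearMap.comp_assoc]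
        congr 1
        ext v
        rw [LinearMap.sub_apply, Representation.dual_apply]
        simp [Module.Dual.transpose_apply]
    exact ⟨n, LinearMap.ext fun f ↦ by rw [e, hn]; simp⟩
  refine ⟨f, hf, fun g v ↦ ?_⟩
  have := congr($(h g⁻¹) v)
  simpa [Representation.dual_apply, Module.Dual.transpose_apply] using this

/-- Unipotent operators in a group are simultaneously unitriangular in a suitable basis. -/
theorem Representation.exists_basis_unitriangular {k G : Type*} [Field k] [Group G] {n : ℕ} :
    ∀ {V : Type*} [AddCommGroup V] [Module k V] [FiniteDimensional k V]
    (ρ : Representation k G V), (∀ g, IsNilpotent (ρ g - 1)) → Module.finrank k V = n →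
    ∃ b : Module.Basis (Fin n) k V, ∀ g i j, j ≤ i →
      b.repr (ρ g (b i)) j = if j = i then 1 else 0 := by
  induction n with
  | zero =>
    intro V _ _ _ ρ _ hV
    exact ⟨Module.finBasisOfFinrankEq k V hV, fun g i ↦ i.elim0⟩
  | succ n ih =>
    intro V _ _ _ ρ hρ hV
    have : Nontrivial V := Module.nontrivial_of_finrank_pos (R := k) (by omega)
    obtain ⟨f, hf, hfix⟩ := ρ.exists_invariant_dual hρ
    let N : Subrepresentation ρ := ⟨LinearMap.ker f, fun g v hv ↦ by
      rw [LinearMap.mem_ker] at hv ⊢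
      rw [hfix, hv]⟩
    have hN : ∀ g (v : LinearMap.ker f), (N.toRepresentation g v : V) = ρ g v := fun g v ↦ rfl
    obtain ⟨b, hb⟩ := ih (V := LinearMap.ker f) N.toRepresentation (fun g ↦ by
      obtain ⟨m, hm⟩ := hρ g
      refine ⟨m, LinearMap.ext fun v ↦ Subtype.ext ?_⟩
      have e : ∀ m (v : LinearMap.ker f),
          (((N.toRepresentation g - 1 : Module.End k (LinearMap.ker f)) ^ m) v : V) =
            ((ρ g - 1 : Module.End k V) ^ m) v := by
        intro m
        induction m with
        | zero => intro v; rfl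
        | succ m ih => intro v; rw [pow_succ, Module.End.mul_apply, ih]; rfl
      exact (e m v).trans (by rw [hm]; rfl))
      (by have := Module.Dual.finrank_ker_add_one_of_ne_zero hf; omega)
    obtain ⟨y, hy⟩ : ∃ y, f y = 1 := by
      obtain ⟨v, hv⟩ := DFunLike.ne_iff.mp hf
      exact ⟨(f v)⁻¹ • v, by simpa using inv_mul_cancel₀ hv⟩
    -- The vector outside the invariant hyperplane comes first, as images involve only later basis
    -- vectors.
    let c := Module.Basis.mkFinCons y b
      (fun a x hx h ↦ by
        have := congr(f $h)
        rw [LinearMap.mem_ker] at hx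
        simpa [hx, hy] using this)
      (fun z ↦ ⟨-f z, by simp [hy]⟩)
    have c0 : c 0 = y := by simp [c]
    have cs : ∀ i : Fin n, c i.succ = b i := fun i ↦ by simp [c]
    have hc0 : c.coord 0 = f := c.ext fun i ↦ by
      refine Fin.cases ?_ (fun i ↦ ?_) i
      · rw [c.coord_apply, c.repr_self, c0, hy, Finsupp.single_eq_same]
      · have : f (b i) = 0 := (b i).2
        rw [c.coord_apply, c.repr_self, cs, this, Finsupp.single_eq_of_ne (Fin.succ_ne_zero i).symm]
    have hcs : ∀ j : Fin n, c.coord j.succ ∘ₗ (LinearMap.ker f).subtype = b.coord j := fun j ↦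
      b.ext fun i ↦ by
        rw [LinearMap.comp_apply, Submodule.subtype_apply, ← cs, c.coord_apply, c.repr_self,
          b.coord_apply, b.repr_self, Finsupp.single_apply, Finsupp.single_apply]
        simp
    refine ⟨c, fun g i j hij ↦ ?_⟩
    rw [← c.coord_apply]
    induction i using Fin.cases with
    | zero =>
      obtain rfl := Fin.le_zero_iff.mp hij
      rw [hc0, hfix, c0, hy, if_pos rfl]
    | succ i =>
      rw [cs]
      induction j using Fin.cases with
      | zero =>
        rw [hc0, hfix, if_neg (Fin.succ_ne_zero i).symm]
        exact (b i).2
      | succ j =>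
        have e := congr($(hcs j) (N.toRepresentation g (b i)))
        rw [b.coord_apply, hb g i j (by simpa using hij)] at e
        simpa only [Fin.succ_inj] using! e

/-! ### Regular cocycles: unipotence, and dimensions up to three -/

section

open Module

lemma Module.End.pow_finrank_eq_zero_of_isNilpotent {k V : Type*} [Field k] [AddCommGroup V]
    [Module k V] [FiniteDimensional k V] {f : End k V} (hf : IsNilpotent f) :
    f ^ finrank k V = 0 := by
  have := LinearMap.aeval_self_charpoly f
  rwa [hf.charpoly_eq_X_pow_finrank, map_pow, Polynomial.aeval_X] at this

lemma Module.Basis.repr_end_apply {F V ι : Type*} [Field F] [AddCommGroup V] [Module F V]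
    [Fintype ι] (b : Basis ι F V) (f : End F V) (v : V) (j : ι) :
    b.repr (f v) j = ∑ i, b.repr v i * b.repr (f (b i)) j := by
  conv_lhs => rw [← b.sum_repr v]
  simp only [map_sum, map_smul, Finsupp.finsetSum_apply, Finsupp.smul_apply, smul_eq_mul]

/-- A faithful linear representation together with a bijective cocycle: the data of a group acting
simply transitively by affine maps, without translations. -/
structure RegularCocycle {F G V : Type*} [Field F] [Group G] [AddCommGroup V] [Module F V]
    (ρ : Representation F G V) (δ : G → V) : Prop where
  cocycle : ∀ g h, δ (g * h) = δ g + ρ g (δ h)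
  bijective : Function.Bijective δ
  faithful : Function.Injective ρ

namespace RegularCocycle

variable {F G V : Type*} [Field F] [Group G] [AddCommGroup V] [Module F V]
  {ρ : Representation F G V} {δ : G → V}

lemma cocycle_one (hδ : RegularCocycle ρ δ) : δ 1 = 0 := by
  have := hδ.cocycle 1 1
  simpa using this

/-- In positive characteristic, the linear part is unipotent. -/
lemma isNilpotent_of_charP [FiniteDimensional F V] [Nontrivial V] (hδ : RegularCocycle ρ δ) (p : ℕ)
    [Fact p.Prime] [CharP F p] (g : G) : IsNilpotent (ρ g - 1) := by
  have : CharP (End F V) p := charP_of_injective_algebraMap (algebraMap F (End F V)).injective p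
  set T := ρ g - 1 with hT
  have hTg : ρ g = 1 + T := by rw [hT]; abel
  have hc : ∀ᶠ n in Filter.atTop, IsCompl (LinearMap.ker (T ^ n)) (LinearMap.range (T ^ n)) :=
    T.eventually_isCompl_ker_pow_range_pow
  obtain ⟨m, hm⟩ := Filter.eventually_atTop.mp hc
  -- For `q = p ^ (m + 1)` this gives `q ≥ 2` and `q - 1 ≥ m`, so that the Fitting decomposition
  -- holds for `T ^ (q - 1)`.
  have hlt : m + 1 < p ^ (m + 1) := Nat.lt_pow_self (Fact.out : p.Prime).one_lt
  have hpow : ∀ k, δ (g ^ k) = (∑ i ∈ Finset.range k, (1 + T) ^ i) (δ g) := by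
    intro k
    induction k with
    | zero => simpa using hδ.cocycle_one
    | succ k ih =>
      rw [pow_succ, hδ.cocycle, ih, Finset.sum_range_succ, map_pow, hTg, LinearMap.add_apply]
  have hgeom : ∑ i ∈ Finset.range (p ^ (m + 1)), (1 + T) ^ i = T ^ (p ^ (m + 1) - 1) := by
    have hF : (∑ i ∈ Finset.range (p ^ (m + 1)), (1 + Polynomial.X : Polynomial F) ^ i) =
        Polynomial.X ^ (p ^ (m + 1) - 1) := by
      apply mul_right_cancel₀ (Polynomial.X_ne_zero (R := F))
      have := geom_sum_mul (1 + Polynomial.X : Polynomial F) (p ^ (m + 1))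
      rw [add_sub_cancel_left, add_pow_char_pow, one_pow, add_sub_cancel_left] at this
      rw [this, ← pow_succ, Nat.sub_add_cancel (by omega)]
    have := congrArg (Polynomial.aeval T) hF
    simpa using this
  have hg : ρ (g ^ p ^ (m + 1)) = 1 + T ^ p ^ (m + 1) := by
    rw [map_pow, hTg, add_pow_char_pow_of_commute _ _ (Commute.one_left T), one_pow]
  obtain ⟨a, ha, b, ⟨c, rfl⟩, hab⟩ : ∃ a ∈ LinearMap.ker (T ^ (p ^ (m + 1) - 1)),
      ∃ b ∈ LinearMap.range (T ^ (p ^ (m + 1) - 1)), a + b = δ g :=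
    Submodule.mem_sup.mp
      ((hm (p ^ (m + 1) - 1) (by omega)).sup_eq_top ▸ Submodule.mem_top)
  -- The affine map of `g ^ q` is `v ↦ T ^ (q - 1) (δ g) + (1 + T ^ q) v`, and `-(T ^ (q - 2)) c` is
  -- a fixed point of it.
  obtain ⟨h, hh⟩ := hδ.bijective.2 (-(T ^ (p ^ (m + 1) - 2)) c)
  have key : δ (g ^ p ^ (m + 1) * h) = δ h := by
    have e : (T ^ p ^ (m + 1)) ((T ^ (p ^ (m + 1) - 2)) c) =
        (T ^ (p ^ (m + 1) - 1)) ((T ^ (p ^ (m + 1) - 1)) c) := by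
      rw [← Module.End.mul_apply, ← Module.End.mul_apply, ← pow_add, ← pow_add]
      congr 2
      omega
    rw [hδ.cocycle, hpow, hgeom, hg, hh, ← hab, map_add, LinearMap.mem_ker.mp ha, map_neg,
      LinearMap.add_apply, e, Module.End.one_apply]
    abel
  have h1 : g ^ p ^ (m + 1) = 1 := mul_eq_right.mp (hδ.bijective.1 key)
  rw [h1, map_one] at hg
  exact ⟨p ^ (m + 1), by simpa using hg.symm⟩

lemma eq_of_apply_basis {ι : Type*} (hδ : RegularCocycle ρ δ) (b : Basis ι F V) {g h : G}
    (e : ∀ i j, b.repr (ρ g (b i)) j = b.repr (ρ h (b i)) j) : g = h :=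
  hδ.faithful (b.ext fun i ↦ b.repr.injective (Finsupp.ext (e i)))

section LowDimension

variable [FiniteDimensional F V] (hδ : RegularCocycle ρ δ) (hρ : ∀ g, IsNilpotent (ρ g - 1))

include hδ hρ

lemma finrank_ne_one : finrank F V ≠ 1 := by
  intro hV
  obtain ⟨b, hb⟩ := ρ.exists_basis_unitriangular hρ hV
  have : ∀ g : G, g = 1 := fun g ↦ hδ.eq_of_apply_basis b fun i j ↦ by
    rw [hb g i j (Subsingleton.elim j i).le, hb 1 i j (Subsingleton.elim j i).le]
  obtain ⟨g, hg⟩ := hδ.bijective.2 (b 0)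
  rw [this g, hδ.cocycle_one] at hg
  exact b.ne_zero 0 hg.symm

lemma finrank_ne_two : finrank F V ≠ 2 := by
  intro hV
  obtain ⟨b, hb⟩ := ρ.exists_basis_unitriangular hρ hV
  let a : G → F := fun g ↦ b.repr (ρ g (b 0)) 1
  let x : G → F := fun g ↦ b.repr (δ g) 0
  let y : G → F := fun g ↦ b.repr (δ g) 1
  have hr : ∀ g v, b.repr (ρ g v) 0 = b.repr v 0 ∧
      b.repr (ρ g v) 1 = b.repr v 0 * a g + b.repr v 1 := fun g v ↦ by
    constructor <;> rw [b.repr_end_apply, Fin.sum_univ_two]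
    · simp [hb g 0 0, hb g 1 0]
    · simp [hb g 1 1, a]
  have ha : ∀ g h, a (g * h) = a g + a h := fun g h ↦ by
    simp only [a, map_mul, Module.End.mul_apply]
    rw [(hr _ _).2, hb h 0 0 le_rfl]
    simp [a]
  have hy : ∀ g h, y (g * h) = y g + (x h * a g + y h) := fun g h ↦ by
    simp only [y, hδ.cocycle, map_add, Finsupp.add_apply, (hr _ _).2, x]
  have hinj : ∀ g h, a g = a h → g = h := fun g h e ↦ hδ.eq_of_apply_basis b fun i j ↦ by
    fin_cases i <;> fin_cases j
    · exact (hb g 0 0 le_rfl).trans (hb h 0 0 le_rfl).symm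
    · exact e
    · exact (hb g 1 0 (by simp)).trans (hb h 1 0 (by simp)).symm
    · exact (hb g 1 1 le_rfl).trans (hb h 1 1 le_rfl).symm
  -- The group embeds into the additive group of `F` by `a`, so it is abelian.
  have key : ∀ g h, x h * a g = x g * a h := fun g h ↦ by
    have := hinj (g * h) (h * g) (by rw [ha, ha, add_comm])
    have := congrArg y this
    rw [hy, hy] at this
    linear_combination this
  obtain ⟨u, hu⟩ := hδ.bijective.2 (b 0)
  obtain ⟨v, hv⟩ := hδ.bijective.2 (b 1)
  have h1 := key u v
  have xu : x u = 1 := by simp [x, hu]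
  have xv : x v = 0 := by simp [x, hv]
  have a1 : a 1 = 0 := by simp [a]
  have : v = 1 := hinj v 1 (by rw [a1]; rw [xu, xv] at h1; linear_combination -h1)
  rw [this, hδ.cocycle_one] at hv
  exact b.ne_zero 1 hv.symm

lemma eq_one_of_finrank_eq_three (hV : finrank F V = 3) (t : F) (ht : t ≠ 0) : t = 1 := by
  obtain ⟨b, hb⟩ := ρ.exists_basis_unitriangular hρ hV
  let a : Fin 3 → Fin 3 → G → F := fun i j g ↦ b.repr (ρ g (b i)) j
  have hr : ∀ g v, b.repr (ρ g v) 0 = b.repr v 0 ∧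
      b.repr (ρ g v) 1 = b.repr v 0 * a 0 1 g + b.repr v 1 ∧
      b.repr (ρ g v) 2 = b.repr v 0 * a 0 2 g + b.repr v 1 * a 1 2 g + b.repr v 2 := fun g v ↦ by
    refine ⟨?_, ?_, ?_⟩ <;> rw [b.repr_end_apply, Fin.sum_univ_three]
    · simp [hb g 0 0, hb g 1 0, hb g 2 0]
    · simp [hb g 1 1, hb g 2 1, a]
    · simp [hb g 2 2, a]
  have ha : ∀ i j g h, a i j (g * h) = b.repr (ρ g (ρ h (b i))) j := fun i j g h ↦ by
    simp only [a, map_mul, Module.End.mul_apply]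
  let D : TriCoords G F :=
    { x := fun g ↦ b.repr (δ g) 0
      y := fun g ↦ b.repr (δ g) 1
      z := fun g ↦ b.repr (δ g) 2
      a := a 0 1
      b := a 1 2
      c := a 0 2
      x_mul := fun g h ↦ by simp only [hδ.cocycle, map_add, Finsupp.add_apply, (hr _ _).1]
      y_mul := fun g h ↦ by
        simp only [hδ.cocycle, map_add, Finsupp.add_apply, (hr _ _).2.1]
        ring
      z_mul := fun g h ↦ by
        simp only [hδ.cocycle, map_add, Finsupp.add_apply, (hr _ _).2.2]
        ring
      a_mul := fun g h ↦ by
        rw [ha, (hr _ _).2.1, hb h 0 0 le_rfl]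
        simp [a]
      b_mul := fun g h ↦ by
        rw [ha, (hr _ _).2.2, hb h 1 0 (by simp), hb h 1 1 le_rfl]
        simp [a]
      c_mul := fun g h ↦ by
        rw [ha, (hr _ _).2.2, hb h 0 0 le_rfl]
        simp [a]
      surj := fun p q r ↦ by
        obtain ⟨g, hg⟩ := hδ.bijective.2 (b.equivFun.symm ![p, q, r])
        have e : ∀ j, b.repr (δ g) j = ![p, q, r] j := fun j ↦ by
          rw [hg, ← b.equivFun_apply, LinearEquiv.apply_symm_apply]
        exact ⟨g, e 0, e 1, e 2⟩
      faithful := fun g h1 h2 h3 ↦ hδ.eq_of_apply_basis b fun i j ↦ by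
        rcases le_or_gt j i with hij | hij
        · rw [hb g i j hij, hb 1 i j hij]
        · rw [map_one, Module.End.one_apply, b.repr_self,
            Finsupp.single_eq_of_ne hij.ne']
          fin_cases i <;> fin_cases j <;> first | exact h1 | exact h2 | exact h3 | simp at hij }
  exact D.eq_one t ht

end LowDimension

end RegularCocycle

/-! ### Dimension four: a central involution and its adapted basis -/

lemma Module.End.eq_zero_of_isNilpotent_of_apply_eq_smul {k V : Type*} [Field k] [AddCommGroup V]
    [Module k V] {f : End k V} (hf : IsNilpotent f) {v : V} (hv : v ≠ 0) {c : k}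
    (h : f v = c • v) : c = 0 := by
  obtain ⟨n, hn⟩ := hf
  have e : ∀ n, (f ^ n) v = c ^ n • v := by
    intro n
    induction n with
    | zero => simp
    | succ n ih => rw [pow_succ, Module.End.mul_apply, h, map_smul, ih, smul_smul, pow_succ']
  have := e n
  rw [hn, LinearMap.zero_apply] at this
  exact eq_zero_of_pow_eq_zero ((smul_eq_zero.mp this.symm).resolve_right hv)

namespace RegularCocycle

variable {F G V : Type*} [Field F] [Group G] [AddCommGroup V] [Module F V]
  {ρ : Representation F G V} {δ : G → V} [FiniteDimensional F V] (hδ : RegularCocycle ρ δ)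
  (hρ : ∀ g, IsNilpotent (ρ g - 1))

include hδ hρ

/-- In dimension four, the group has nontrivial center. -/
lemma exists_central_ne_one (hV : finrank F V = 4) : ∃ z : G, z ≠ 1 ∧ ∀ h, z * h = h * z := by
  obtain ⟨b, hb⟩ := ρ.exists_basis_unitriangular hρ hV
  let a : Fin 4 → Fin 4 → G → F := fun i j g ↦ b.repr (ρ g (b i)) j
  have hr : ∀ g v, b.repr (ρ g v) 0 = b.repr v 0 ∧
      b.repr (ρ g v) 1 = b.repr v 0 * a 0 1 g + b.repr v 1 ∧
      b.repr (ρ g v) 2 = b.repr v 0 * a 0 2 g + b.repr v 1 * a 1 2 g + b.repr v 2 ∧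
      b.repr (ρ g v) 3 = b.repr v 0 * a 0 3 g + b.repr v 1 * a 1 3 g + b.repr v 2 * a 2 3 g
        + b.repr v 3 := fun g v ↦ by
    refine ⟨?_, ?_, ?_, ?_⟩ <;> rw [b.repr_end_apply, Fin.sum_univ_four]
    · simp [hb g 0 0, hb g 1 0, hb g 2 0, hb g 3 0]
    · simp [hb g 1 1, hb g 2 1, hb g 3 1, a]
    · simp [hb g 2 2, hb g 3 2, a]
    · simp [hb g 3 3, a]
  have ha : ∀ i j g h, a i j (g * h) = b.repr (ρ g (ρ h (b i))) j := fun i j g h ↦ by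
    simp only [a, map_mul, Module.End.mul_apply]
  have a01 : ∀ g h, a 0 1 (g * h) = a 0 1 g + a 0 1 h := fun g h ↦ by
    rw [ha, (hr _ _).2.1, hb h 0 0 le_rfl]
    simp [a]
  have a12 : ∀ g h, a 1 2 (g * h) = a 1 2 g + a 1 2 h := fun g h ↦ by
    rw [ha, (hr _ _).2.2.1, hb h 1 0 (by simp), hb h 1 1 le_rfl]
    simp [a]
  have a23 : ∀ g h, a 2 3 (g * h) = a 2 3 g + a 2 3 h := fun g h ↦ by
    rw [ha, (hr _ _).2.2.2, hb h 2 0 (by simp), hb h 2 1 (by simp), hb h 2 2 le_rfl]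
    simp [a]
  have a02 : ∀ g h, a 0 2 (g * h) = a 0 2 g + a 0 1 h * a 1 2 g + a 0 2 h := fun g h ↦ by
    rw [ha, (hr _ _).2.2.1, hb h 0 0 le_rfl]
    simp [a]
  have a13 : ∀ g h, a 1 3 (g * h) = a 1 3 g + a 1 2 h * a 2 3 g + a 1 3 h := fun g h ↦ by
    rw [ha, (hr _ _).2.2.2, hb h 1 0 (by simp), hb h 1 1 le_rfl]
    simp [a]
  have a03 : ∀ g h, a 0 3 (g * h) = a 0 3 g + a 0 1 h * a 1 3 g + a 0 2 h * a 2 3 g + a 0 3 h :=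
    fun g h ↦ by
      rw [ha, (hr _ _).2.2.2, hb h 0 0 le_rfl]
      simp [a]
  have hinj : ∀ g h, a 0 1 g = a 0 1 h → a 1 2 g = a 1 2 h → a 2 3 g = a 2 3 h →
      a 0 2 g = a 0 2 h → a 1 3 g = a 1 3 h → a 0 3 g = a 0 3 h → g = h :=
    fun g h h1 h2 h3 h4 h5 h6 ↦ hδ.eq_of_apply_basis b fun i j ↦ by
      rcases le_or_gt j i with hij | hij
      · rw [hb g i j hij, hb h i j hij]
      · fin_cases i <;> fin_cases j <;>
          first | exact h1 | exact h2 | exact h3 | exact h4 | exact h5 | exact h6 | simp at hij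
  have h1 : ∀ i j, i ≠ j → a i j 1 = 0 := fun i j hij ↦ by
    simp [a, Finsupp.single_eq_of_ne hij.symm]
  -- Commutators move down the superdiagonals. A nontrivial element with only a corner entry is
  -- central; if there is none, any element with zero first superdiagonal is central; if all such
  -- are trivial, the group is abelian.
  by_cases hc : ∃ g : G, g ≠ 1 ∧ a 0 1 g = 0 ∧ a 1 2 g = 0 ∧ a 2 3 g = 0 ∧ a 0 2 g = 0 ∧ a 1 3 g = 0
  · obtain ⟨g, g1, h1, h2, h3, h4, h5⟩ := hc
    refine ⟨g, g1, fun h ↦ ?_⟩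
    apply hinj <;> simp only [a01, a12, a23, a02, a13, a03, h1, h2, h3, h4, h5] <;> ring
  push Not at hc
  by_cases hc' : ∃ g : G, g ≠ 1 ∧ a 0 1 g = 0 ∧ a 1 2 g = 0 ∧ a 2 3 g = 0
  · obtain ⟨g, g1, h1, h2, h3⟩ := hc'
    refine ⟨g, g1, fun h ↦ ?_⟩
    obtain ⟨k, hk⟩ : ∃ k, g * h * k = h * g := ⟨(g * h)⁻¹ * (h * g), by group⟩
    have e01 := congrArg (a 0 1) hk
    have e12 := congrArg (a 1 2) hk
    have e23 := congrArg (a 2 3) hk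
    have e02 := congrArg (a 0 2) hk
    have e13 := congrArg (a 1 3) hk
    simp only [a01, a12, a23, a02, a13, h1, h2, h3] at e01 e12 e23 e02 e13
    have k01 : a 0 1 k = 0 := by linear_combination e01
    have k12 : a 1 2 k = 0 := by linear_combination e12
    have k23 : a 2 3 k = 0 := by linear_combination e23
    rw [k01] at e02
    rw [k12] at e13
    have : k = 1 := by
      by_contra k1
      exact hc k k1 k01 k12 k23 (by linear_combination e02) (by linear_combination e13)
    rw [← hk, this, mul_one]
  push Not at hc'
  have : Nontrivial V := Module.nontrivial_of_finrank_pos (R := F) (by omega)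
  obtain ⟨v, hv⟩ := exists_ne (0 : V)
  obtain ⟨g, rfl⟩ := hδ.bijective.2 v
  refine ⟨g, fun h ↦ hv (h ▸ hδ.cocycle_one), fun h ↦ ?_⟩
  obtain ⟨k, hk⟩ : ∃ k, g * h * k = h * g := ⟨(g * h)⁻¹ * (h * g), by group⟩
  have e01 := congrArg (a 0 1) hk
  have e12 := congrArg (a 1 2) hk
  have e23 := congrArg (a 2 3) hk
  simp only [a01, a12, a23] at e01 e12 e23
  have : k = 1 := by
    by_contra k1
    exact hc' k k1 (by linear_combination e01) (by linear_combination e12)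
      (by linear_combination e23)
  rw [← hk, this, mul_one]

lemma exists_central_involution [CharP F 2] (hV : finrank F V = 4) :
    ∃ z : G, z ≠ 1 ∧ z * z = 1 ∧ ∀ h, z * h = h * z := by
  obtain ⟨z, z1, hz⟩ := hδ.exists_central_ne_one hρ hV
  by_cases hzz : z * z = 1
  · exact ⟨z, z1, hzz, hz⟩
  refine ⟨z * z, hzz, hδ.faithful ?_, fun h ↦ by
    rw [mul_assoc, hz h, ← mul_assoc, hz h, mul_assoc]⟩
  have : Nontrivial V := Module.nontrivial_of_finrank_pos (R := F) (by omega)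
  have : CharP (End F V) 2 := charP_of_injective_algebraMap (algebraMap F (End F V)).injective 2
  -- In characteristic two, `(ρ z - 1) ^ 4 = 0` says `ρ z ^ 4 = 1`.
  have h4 := Module.End.pow_finrank_eq_zero_of_isNilpotent (hρ z)
  rw [hV, show 4 = 2 ^ 2 from rfl, sub_pow_char_pow_of_commute _ _ (Commute.one_right (ρ z)), one_pow,
    sub_eq_zero] at h4
  rw [map_one, ← h4, ← map_pow, pow_two 2, pow_mul, pow_two, pow_two]

/-- In characteristic two and dimension four, a basis adapted to a central involution yields
coordinates for the group. -/
lemma nonempty_centralCoords [CharP F 2] (hV : finrank F V = 4) :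
    Nonempty (CentralCoords G F) := by
  obtain ⟨z, z1, hzz, hz⟩ := hδ.exists_central_involution hρ hV
  have two : (2 : F) = 0 := CharTwo.two_eq_zero
  have hneg : ∀ v : V, -v = v := fun v ↦ by
    rw [neg_eq_iff_add_eq_zero, ← two_smul F, two, zero_smul]
  set T := ρ z - 1 with hT
  set w := δ z with hw
  have hTa : ∀ v, T v = ρ z v - v := fun v ↦ rfl
  have hz2 : ∀ v, ρ z (ρ z v) = v := fun v ↦ by
    rw [← Module.End.mul_apply, ← map_mul, hzz, map_one, Module.End.one_apply]
  have hTT : ∀ v, T (T v) = 0 := fun v ↦ by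
    rw [hTa, hTa, map_sub, hz2, sub_eq_zero, ← neg_sub, hneg]
  have hTw : T w = 0 := by
    have := hδ.cocycle z z
    rw [hzz, hδ.cocycle_one] at this
    rw [hTa, sub_eq_add_neg, hneg, add_comm, ← this]
  have hTρ : ∀ h v, T (ρ h v) = ρ h (T v) := fun h v ↦ by
    rw [hTa, hTa, map_sub, ← Module.End.mul_apply, ← map_mul, hz, map_mul, Module.End.mul_apply]
  have hρw : ∀ h, ρ h w = w + T (δ h) := fun h ↦ by
    have := congrArg δ (hz h)
    rw [hδ.cocycle, hδ.cocycle] at this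
    rw [hTa, add_sub, this, add_sub_cancel_left]
  have hw0 : w ≠ 0 := fun h ↦ z1 (hδ.bijective.1 (h.trans hδ.cocycle_one.symm))
  have hT0 : T ≠ 0 := fun h ↦ z1 (hδ.faithful (by rw [map_one, ← sub_eq_zero]; exact h))
  -- If `w = T (δ h)`, then `ρ h - 1` would fix the nonzero vector `w`, against nilpotency.
  have hwT : ∀ u, T u ≠ w := by
    intro u hu
    obtain ⟨h, rfl⟩ := hδ.bijective.2 u
    refine one_ne_zero (Module.End.eq_zero_of_isNilpotent_of_apply_eq_smul (hρ h) hw0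
      (c := (1 : F)) ?_)
    rw [one_smul, LinearMap.sub_apply, hρw, hu, Module.End.one_apply, add_sub_cancel_right]
  -- The range of `T` lies in its kernel, strictly because `w` is in the kernel only; in dimension
  -- four the rank is therefore below two.
  have hrank : finrank F (LinearMap.range T) = 1 := by
    have h1 := LinearMap.finrank_range_add_finrank_ker T
    have h2 : LinearMap.range T < LinearMap.ker T := by
      refine lt_of_le_of_ne ?_ ?_
      · rintro _ ⟨v, rfl⟩
        exact hTT v
      · intro h
        obtain ⟨u, hu⟩ : w ∈ LinearMap.range T := h ▸ hTw
        exact hwT u hu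
    have h3 := Submodule.finrank_lt_finrank_of_lt h2
    have h4 : finrank F (LinearMap.range T) ≠ 0 := fun h ↦
      hT0 (LinearMap.range_eq_bot.mp (Submodule.finrank_eq_zero.mp h))
    omega
  obtain ⟨e₁, he₁⟩ : ∃ e, T e ≠ 0 := by
    by_contra! h
    exact hT0 (LinearMap.ext h)
  have hTe : ∀ v, ∃ c : F, T v = c • T e₁ := fun v ↦ by
    obtain ⟨c, hc⟩ := (finrank_eq_one_iff_of_nonzero' (⟨T e₁, e₁, rfl⟩ : LinearMap.range T)
      (fun h ↦ he₁ congr(($h).1))).mp hrank ⟨T v, v, rfl⟩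
    exact ⟨c, by simpa using congr(($hc).1).symm⟩
  obtain ⟨e₂, he₂, he₂'⟩ : ∃ e, T e = 0 ∧ e ∉ Submodule.span F {w, T e₁} := by
    by_contra! h
    have h1 : LinearMap.ker T ≤ Submodule.span F {w, T e₁} := fun v hv ↦ h v hv
    have h2 := Submodule.finrank_mono h1
    have h3 := LinearMap.finrank_range_add_finrank_ker T
    have h4 : finrank F (Submodule.span F {w, T e₁}) ≤ 2 := by
      classical
      have := finrank_span_finset_le_card (R := F) ({w, T e₁} : Finset V)
      simp only [Finset.coe_pair] at this
      exact this.trans Finset.card_le_two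
    omega
  have hli : LinearIndependent F ![e₁, e₂, w, T e₁] := by
    rw [Fintype.linearIndependent_iff]
    intro c hc
    simp only [Fin.sum_univ_four, Matrix.cons_val] at hc
    have c0 : c 0 = 0 := by
      have := congrArg T hc
      simp only [map_add, map_smul, he₂, hTw, hTT, map_zero, smul_zero, add_zero] at this
      exact (smul_eq_zero.mp this).resolve_right he₁
    rw [c0, zero_smul, zero_add] at hc
    have c1 : c 1 = 0 := by
      by_contra h
      apply he₂'
      rw [Submodule.mem_span_pair]
      refine ⟨-(c 1)⁻¹ * c 2, -(c 1)⁻¹ * c 3, ?_⟩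
      linear_combination (norm := module) -(c 1)⁻¹ • hc + inv_mul_cancel₀ h • e₂
    rw [c1, zero_smul, zero_add] at hc
    have c2 : c 2 = 0 := by
      by_contra h
      apply hwT (-((c 2)⁻¹ * c 3) • e₁)
      rw [map_smul]
      linear_combination (norm := module) -(c 2)⁻¹ • hc + inv_mul_cancel₀ h • w
    rw [c2, zero_smul, zero_add] at hc
    have c3 := (smul_eq_zero.mp hc).resolve_right he₁
    intro i
    fin_cases i <;> assumption
  let b := basisOfLinearIndependentOfCardEqFinrank hli (by simp [hV])
  have hbv : ∀ i, b i = ![e₁, e₂, w, T e₁] i := fun i ↦ by simp [b]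
  have b0 : b 0 = e₁ := hbv 0
  have b1 : b 1 = e₂ := hbv 1
  have b2 : b 2 = w := hbv 2
  have b3 : b 3 = T e₁ := hbv 3
  have hTr : ∀ v, T v = b.repr v 0 • b 3 := fun v ↦ by
    conv_lhs => rw [← b.sum_repr v]
    simp only [Fin.sum_univ_four, map_add, map_smul, b0, b1, b2, b3, he₂, hTw, hTT]
    simp
  have hρ3 : ∀ h, ρ h (b 3) = b 3 := fun h ↦ by
    obtain ⟨c, hc⟩ := hTe (ρ h e₁ - e₁)
    rw [map_sub, hTρ, ← b3] at hc
    have := Module.End.eq_zero_of_isNilpotent_of_apply_eq_smul (hρ h) (b.ne_zero 3) hc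
    rwa [this, zero_smul, sub_eq_zero] at hc
  -- Here the last superdiagonal entry becomes the first translation coordinate, because `z` is
  -- central.
  have hρ2 : ∀ h, ρ h (b 2) = b 2 + b.repr (δ h) 0 • b 3 := fun h ↦ by
    rw [b2, hρw, hTr]
  have h00 : ∀ h v, b.repr (ρ h v) 0 = b.repr v 0 := fun h v ↦ by
    have := hTρ h v
    rw [hTr, hTr, map_smul, hρ3] at this
    exact smul_left_injective F (b.ne_zero 3) this
  have h11 : ∀ h, b.repr (ρ h (b 1)) 1 = 1 := fun h ↦ by
    obtain ⟨n, hn⟩ := hρ h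
    have e : ∀ n, b.repr (((ρ h - 1) ^ n) (b 1)) 0 = 0 ∧
        b.repr (((ρ h - 1) ^ n) (b 1)) 1 = (b.repr (ρ h (b 1)) 1 - 1) ^ n := by
      intro n
      induction n with
      | zero => simp
      | succ n ih =>
        rw [pow_succ', Module.End.mul_apply]
        set v := ((ρ h - 1) ^ n) (b 1)
        rw [LinearMap.sub_apply, Module.End.one_apply, map_sub, Finsupp.sub_apply,
          Finsupp.sub_apply, h00, sub_self, b.repr_end_apply, Fin.sum_univ_four, hρ2, hρ3, ih.1, ih.2]
        refine ⟨rfl, ?_⟩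
        simp
        ring
    have := (e n).2
    rw [hn] at this
    simp only [LinearMap.zero_apply, map_zero, Finsupp.zero_apply] at this
    exact sub_eq_zero.mp (eq_zero_of_pow_eq_zero this.symm)
  let a : Fin 4 → Fin 4 → G → F := fun i j g ↦ b.repr (ρ g (b i)) j
  have hr : ∀ g v, b.repr (ρ g v) 0 = b.repr v 0 ∧
      b.repr (ρ g v) 1 = b.repr v 0 * a 0 1 g + b.repr v 1 ∧
      b.repr (ρ g v) 2 = b.repr v 0 * a 0 2 g + b.repr v 1 * a 1 2 g + b.repr v 2 ∧
      b.repr (ρ g v) 3 = b.repr v 0 * a 0 3 g + b.repr v 1 * a 1 3 g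
        + b.repr v 2 * b.repr (δ g) 0 + b.repr v 3 := fun g v ↦ by
    refine ⟨h00 g v, ?_, ?_, ?_⟩ <;> rw [b.repr_end_apply, Fin.sum_univ_four, hρ2, hρ3]
    · simp [h11, a]
    · simp [a]
    · simp [a]
  have ha : ∀ i j g h, a i j (g * h) = b.repr (ρ g (ρ h (b i))) j := fun i j g h ↦ by
    simp only [a, map_mul, Module.End.mul_apply]
  have hi0 : ∀ h, b.repr (ρ h (b 0)) 0 = 1 := fun h ↦ by simp [h00]
  have hi1 : ∀ h, b.repr (ρ h (b 1)) 0 = 0 := fun h ↦ by simp [h00]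
  exact ⟨{
    x₁ := fun g ↦ b.repr (δ g) 0
    x₂ := fun g ↦ b.repr (δ g) 1
    x₃ := fun g ↦ b.repr (δ g) 2
    x₄ := fun g ↦ b.repr (δ g) 3
    a₁₂ := a 0 1
    a₁₃ := a 0 2
    a₁₄ := a 0 3
    a₂₃ := a 1 2
    a₂₄ := a 1 3
    x₁_mul := fun g h ↦ by simp only [hδ.cocycle, map_add, Finsupp.add_apply, (hr _ _).1]
    x₂_mul := fun g h ↦ by
      simp only [hδ.cocycle, map_add, Finsupp.add_apply, (hr _ _).2.1]
      ring
    x₃_mul := fun g h ↦ by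
      simp only [hδ.cocycle, map_add, Finsupp.add_apply, (hr _ _).2.2.1]
      ring
    x₄_mul := fun g h ↦ by
      simp only [hδ.cocycle, map_add, Finsupp.add_apply, (hr _ _).2.2.2]
      ring
    a₁₂_mul := fun g h ↦ by
      rw [ha, (hr _ _).2.1, hi0]
      simp [a]
    a₁₃_mul := fun g h ↦ by
      rw [ha, (hr _ _).2.2.1, hi0]
      simp [a]
    a₁₄_mul := fun g h ↦ by
      rw [ha, (hr _ _).2.2.2, hi0]
      simp [a]
    a₂₃_mul := fun g h ↦ by
      rw [ha, (hr _ _).2.2.1, hi1, h11]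
      simp [a]
    a₂₄_mul := fun g h ↦ by
      rw [ha, (hr _ _).2.2.2, hi1, h11]
      simp [a]
    surj := fun p q r s ↦ by
      obtain ⟨g, hg⟩ := hδ.bijective.2 (b.equivFun.symm ![p, q, r, s])
      have e : ∀ j, b.repr (δ g) j = ![p, q, r, s] j := fun j ↦ by
        rw [hg, ← b.equivFun_apply, LinearEquiv.apply_symm_apply]
      exact ⟨g, e 0, e 1, e 2, e 3⟩
    faithful := fun g h1 h2 h3 h4 h5 h6 ↦ hδ.faithful (b.ext fun i ↦ by
      have e : ∀ v, b.repr (ρ g v) = b.repr v := fun v ↦ by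
        ext j
        have := hr g v
        rw [h1, h2, h3, h4, h5, h6] at this
        simp only [mul_zero, zero_add] at this
        fin_cases j
        exacts [this.1, this.2.1, this.2.2.1, this.2.2.2]
      rw [map_one, Module.End.one_apply, b.repr.injective (e (b i))]) }⟩

lemma finrank_ne_four_of_charTwo [CharP F 2] : finrank F V ≠ 4 := fun hV ↦
  (hδ.nonempty_centralCoords hρ hV).elim CentralCoords.false

end RegularCocycle

end

/-! ### From regular affine groups to regular cocycles -/

namespace AGL

variable {n : ℕ} {F : Type*} [Field F] (R : Subgroup (AGL n F))

/-- The linear part of a subgroup of the affine group, acting on the right on row vectors. -/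
def rowRep : Representation F Rᵐᵒᵖ (Fin n → F) where
  toFun r := Matrix.vecMulLinear (linearPart (r.unop : AGL n F) : Matrix (Fin n) (Fin n) F)
  map_one' := by
    ext v
    simp
  map_mul' r s := by
    refine LinearMap.ext fun v ↦ ?_
    simp [Matrix.vecMul_vecMul]

lemma rowRep_apply (r : Rᵐᵒᵖ) (v : Fin n → F) : rowRep R r v =
    Matrix.vecMul v (linearPart (r.unop : AGL n F) : Matrix (Fin n) (Fin n) F) := rfl

/-- The image of the origin under an element of a subgroup of the affine group. -/
def rowCocycle (r : Rᵐᵒᵖ) : Fin n → F := fun j ↦ toMatrix (r.unop : AGL n F) 0 j.succ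

variable {R}

lemma toMatrix_zero (r : Rᵐᵒᵖ) :
    toMatrix (r.unop : AGL n F) 0 = (Fin.cons 1 (rowCocycle R r) : Fin (n + 1) → F) := by
  funext j
  refine Fin.cases ?_ (fun j ↦ rfl) j
  exact (r.unop : AGL n F).2.1

/-- A regular subgroup without nontrivial translations acts by a bijective cocycle. -/
lemma regularCocycle (hR : IsRegular R) (h : ∀ r ∈ R, r ∈ translations n F → r = 1) :
    RegularCocycle (rowRep R) (rowCocycle R) where
  cocycle r s := by
    funext j
    have e : toMatrix ((r * s).unop : AGL n F) =
      toMatrix (s.unop : AGL n F) * toMatrix (r.unop : AGL n F) := rfl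
    rw [rowCocycle, e, Matrix.mul_apply, Fin.sum_univ_succ, toMatrix_zero s]
    simp only [Fin.cons_zero, Fin.cons_succ, one_mul]
    rfl
  bijective := by
    refine ⟨fun r s hrs ↦ ?_, fun v ↦ ?_⟩
    · apply MulOpposite.unop_injective
      apply Subtype.ext
      exact (hR (rowCocycle R r)).unique ⟨r.unop.2, toMatrix_zero r⟩
        ⟨s.unop.2, hrs ▸ toMatrix_zero s⟩
    · obtain ⟨r, ⟨hr, hv⟩, -⟩ := hR v
      exact ⟨MulOpposite.op ⟨r, hr⟩, funext fun j ↦ congrFun hv j.succ⟩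
  faithful := by
    rw [injective_iff_map_eq_one]
    intro r hr
    apply MulOpposite.unop_injective
    apply Subtype.ext
    refine h _ r.unop.2 ?_
    rw [translations, MonoidHom.mem_ker]
    refine Units.ext (Matrix.ext fun i j ↦ ?_)
    have := congr($hr (Pi.single i 1) j)
    rw [rowRep_apply, Matrix.single_one_vecMul] at this
    simpa [Matrix.one_apply, Pi.single_apply, eq_comm] using! this

/-- The rows `(0, v)` are stable under `M - 1`, which acts on them as `rowRep R r - 1`. -/
lemma isNilpotent_rowRep_sub_one (r : Rᵐᵒᵖ)
    (hr : IsNilpotent (toMatrix (r.unop : AGL n F) - 1)) : IsNilpotent (rowRep R r - 1) := by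
  obtain ⟨k, hk⟩ := hr
  set M := toMatrix (r.unop : AGL n F) with hM
  have e : ∀ v : Fin n → F, Matrix.vecMul (Fin.cons 0 v : Fin (n + 1) → F) (M - 1) =
      (Fin.cons 0 ((rowRep R r - 1) v) : Fin (n + 1) → F) := by
    intro v
    have h0 : ∀ i : Fin n, M i.succ 0 = 0 := (r.unop : AGL n F).2.2
    rw [Matrix.vecMul_sub, Matrix.vecMul_one]
    funext j
    refine Fin.cases ?_ (fun j ↦ ?_) j
    · simp [Matrix.vecMul, dotProduct, Fin.sum_univ_succ, h0]
    · simp only [Pi.sub_apply, Matrix.vecMul, dotProduct, Fin.sum_univ_succ, Fin.cons_zero,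
        Fin.cons_succ, zero_mul, zero_add]
      rfl
  have e' : ∀ k, ∀ v : Fin n → F, Matrix.vecMul (Fin.cons 0 v : Fin (n + 1) → F) ((M - 1) ^ k) =
      (Fin.cons 0 (((rowRep R r - 1 : Module.End F (Fin n → F)) ^ k) v) : Fin (n + 1) → F) := by
    intro k
    induction k with
    | zero => simp
    | succ k ih =>
      intro v
      rw [pow_succ', ← Matrix.vecMul_vecMul, e, ih, pow_succ, Module.End.mul_apply]
  refine ⟨k, LinearMap.ext fun v ↦ funext fun j ↦ ?_⟩
  have := congrFun (e' k v) j.succ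
  rw [hk, Matrix.vecMul_zero, Fin.cons_succ] at this
  exact this.symm

end AGL

theorem theorem1 {F : Type*} [Field F] (n : ℕ) (hn : 1 ≤ n)
    (R : Subgroup (AGL n F)) (hR : AGL.IsRegular R)
    (hU : CharZero F → AGL.IsUnipotent R)
    (h : n ≤ 2 ∨ (n = 3 ∧ Nat.card F ≠ 2) ∨ (n = 4 ∧ CharP F 2)) :
    ∃ r ∈ R, r ∈ AGL.translations n F ∧ r ≠ 1 := by
  by_contra! hT
  have hδ := AGL.regularCocycle hR hT
  have : Nonempty (Fin n) := ⟨⟨0, hn⟩⟩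
  have hρ : ∀ g, IsNilpotent (AGL.rowRep R g - 1) := by
    intro g
    obtain ⟨p, hp⟩ := CharP.exists F
    rcases CharP.char_is_prime_or_zero F p with hp' | rfl
    · have : Fact p.Prime := ⟨hp'⟩
      exact hδ.isNilpotent_of_charP p g
    · exact AGL.isNilpotent_rowRep_sub_one g
        (hU (CharP.charP_to_charZero F) _ g.unop.2)
  have hV : Module.finrank F (Fin n → F) = n := by simp
  rcases h with h | ⟨rfl, h⟩ | ⟨rfl, h⟩
  · obtain rfl | rfl : n = 1 ∨ n = 2 := by omega
    · exact hδ.finrank_ne_one hρ hV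
    · exact hδ.finrank_ne_two hρ hV
  · refine h (Nat.card_eq_two_iff.mpr ⟨0, 1, zero_ne_one, Set.eq_univ_of_forall fun t ↦ ?_⟩)
    by_cases ht : t = 0
    · exact Or.inl ht
    · exact Or.inr (hδ.eq_one_of_finrank_eq_three hρ hV t ht)
  · exact hδ.finrank_ne_four_of_charTwo hρ hV
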